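/- Let $n,m\in\mathbb{N}_0$, let $b=[b_1\ \cdots\ b_n]\in L^2([0,1],\mathbb{R})^{1\times n}$, $G\in\mathbb{R}^{n\times n}$, $H\in\mathbb{R}^{n\times m}$, $F_2\in\mathbb{C}^{m\times n}$ and $f\in\mathbb{C}^m$. Write $L^2(0,1)=L^2([0,1],\mathbb{C})$ with inner product $\langle\cdot,\cdot\rangle_{L^2}$ linear in the first argument, and let $\phi_0(\xi)=1$, $\phi_k(\xi)=\sqrt2\cos(k\pi\xi)$ for $k\ge1$. Consider the heat equation with Neumann boundary conditions in cascade with an ODE, \[ \partial_t z_1=\partial_\xi^2 z_1+b(\xi)z_2(t),\quad \partial_\xi z_1(0,t)=\partial_\xi z_1(1,t)=0,\qquad \dot z_2=Gz_2+Hu , \] written as $\dot x=Ax+Bu$ on the Hilbert space $X=L^2(0,1)\times\mathbb{C}^n$ (with inner product $\langle x_1,y_1\rangle_{L^2}+\langle x_2,y_2\rangle_{\mathbb{C}^n}$), where \[ A=\begin{bmatrix}A_1&B_1\\0&G\end{bmatrix},\quad D(A)=D(A_1)\times\mathbb{C}^n,\qquad B=\begin{bmatrix}0\\H\end{bmatrix},\qquad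 B_1x_2=bx_2, \] \[ A_1x_1=-\sum_{k=0}^\infty k^2\pi^2\langle x_1,\phi_k\rangle_{L^2}\phi_k,\qquad D(A_1)=\Big\{x_1\in L^2(0,1):\sum_{k=0}^\infty k^4\pi^4|\langle x_1,\phi_k\rangle_{L^2}|^2<\infty\Big\}. \] Let $F=[F_1\ F_2]$ with $F_1x_1=f\langle x_1,\phi_0\rangle_{L^2}$ for $x_1\in L^2(0,1)$, and put $B^+=[\langle b_1,\phi_0\rangle_{L^2}\ \cdots\ \langle b_n,\phi_0\rangle_{L^2}]$. Then $A+BF$, with domain $D(A)$, generates a strongly continuous semigroup $T_{BF}(t)$ on $X$. If moreover the rational functions \[ \mathbf{G}_1(\lambda)=\big(\lambda-B^+(\lambda I-G-HF_2)^{-1}Hf\big)^{-1},\qquad \mathbf{G}_2(\lambda)=(\lambda I-G-HF_2)^{-1} \] (the latter matrix-valued; its poles are those of its entries) have poles only in the open left half plane $\{\lambda\in\mathbb{C}:\operatorname{Re}\lambda<0\}$, then $T_{BF}(t)$ is exponentially stable, that is, its exponential growth bound $\omega(T_{BF})=\lim_{t\to\infty}\ln\|T_{BF}(t)\|/t$ is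 negative. -/

import Mathlib

open MeasureTheory Filter Topology
open scoped NNReal ENNReal

noncomputable section

/-! ### Strongly continuous semigroups -/

/-- A strongly continuous semigroup of bounded linear operators on a complex normed space. -/
structure C0Semigroup (X : Type*) [NormedAddCommGroup X] [NormedSpace ℂ X] where
  /-- the operator at time `t ≥ 0` -/
  op : ℝ≥0 → X →L[ℂ] X
  op_zero : op 0 = ContinuousLinearMap.id ℂ X
  op_add : ∀ s t : ℝ≥0, op (s + t) = (op s).comp (op t)
  tendsto_zero : ∀ x : X, Tendsto (fun t : ℝ≥0 => op t x) (𝓝 0) (𝓝 x)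

namespace C0Semigroup

variable {X : Type*} [NormedAddCommGroup X] [NormedSpace ℂ X]

/-- `A` is the (infinitesimal) generator of `T`: the pair `(x, y)` belongs to the graph of `A`
exactly if `(T(h) x - x) / h → y` as `h ↓ 0`. In particular the domain of `A` consists of all `x`
for which this limit exists. -/
def IsGeneratedBy (T : C0Semigroup X) (A : X →ₗ.[ℂ] X) : Prop :=
  ∀ x y : X, (x, y) ∈ A.graph ↔
    Tendsto (fun h : ℝ≥0 => ((h : ℝ) : ℂ)⁻¹ • (T.op h x - x)) (𝓝[>] 0) (𝓝 y)

/-- `ω` is the exponential growth bound of `T`, i.e. `ω = lim_{t → ∞} ln ‖T(t)‖ / t`, as an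
extended real number, with `ln 0 = -∞`. -/
def HasGrowthBound (T : C0Semigroup X) (ω : EReal) : Prop :=
  Tendsto (fun t : ℝ≥0 => ENNReal.log ‖T.op t‖ₑ / ((t : ℝ) : EReal)) atTop (𝓝 ω)

/-- `T` is exponentially stable: its exponential growth bound is negative. -/
def IsExponentiallyStable (T : C0Semigroup X) : Prop :=
  ∃ ω : EReal, T.HasGrowthBound ω ∧ ω < 0

end C0Semigroup

/-! ### Poles of rational functions -/

/-- `z` is a pole of the rational function `r`: it is a zero of the denominator of `r` in lowest
terms. -/
def RatFunc.IsPole (r : RatFunc ℂ) (z : ℂ) : Prop :=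
  r.denom.IsRoot z

namespace HeatODE

/-! ### The space `L²(0,1)` and the orthonormal system of cosines -/

/-- Lebesgue measure on the unit interval. -/
abbrev unitMeasure : Measure ℝ := volume.restrict (Set.Icc (0 : ℝ) 1)

/-- The complex Hilbert space `L²(0,1)`. -/
abbrev L2 : Type := Lp ℂ 2 unitMeasure

/-- The functions `1` (for `k = 0`) and `√2 cos (k π ξ)` (for `k ≥ 1`). -/
def phiFun (k : ℕ) (ξ : ℝ) : ℝ :=
  if k = 0 then 1 else √2 * Real.cos (k * Real.pi * ξ)

lemma continuous_phiFun (k : ℕ) : Continuous (phiFun k) := by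
  unfold phiFun
  split_ifs <;> fun_prop

lemma abs_phiFun_le (k : ℕ) (ξ : ℝ) : |phiFun k ξ| ≤ √2 := by
  unfold phiFun
  split_ifs
  · simp
  · rw [abs_mul, abs_of_nonneg (Real.sqrt_nonneg 2)]
    exact mul_le_of_le_one_right (Real.sqrt_nonneg 2) (Real.abs_cos_le_one _)

lemma memLp_phiFun (k : ℕ) : MemLp (fun ξ => (phiFun k ξ : ℂ)) 2 unitMeasure := by
  refine MemLp.of_bound
    (Complex.continuous_ofReal.comp (continuous_phiFun k)).aestronglyMeasurable (√2) ?_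
  exact Eventually.of_forall fun ξ => by
    simpa [Complex.norm_real] using abs_phiFun_le k ξ

/-- `φ_k` as an element of `L²(0,1)`. -/
def phi (k : ℕ) : L2 := (memLp_phiFun k).toLp

lemma integral_cos_int (k : ℤ) :
    ∫ x in (0 : ℝ)..1, Real.cos (k * Real.pi * x) = if k = 0 then 1 else 0 := by
  split_ifs with h
  · simp [h]
  · have hk : (k : ℝ) * Real.pi ≠ 0 := mul_ne_zero (by exact_mod_cast h) Real.pi_ne_zero
    rw [intervalIntegral.integral_comp_mul_left (fun x => Real.cos x) hk]
    simp [Real.sin_int_mul_pi]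

lemma integral_phiFun_mul (j k : ℕ) :
    ∫ x in (0 : ℝ)..1, phiFun j x * phiFun k x = if j = k then 1 else 0 := by
  have key : ∀ j k : ℕ, ∫ x in (0 : ℝ)..1,
      Real.cos (j * Real.pi * x) * Real.cos (k * Real.pi * x)
        = ((if (j : ℤ) - k = 0 then 1 else 0) + (if (j : ℤ) + k = 0 then 1 else 0)) / 2 := by
    intro j k
    rw [← integral_cos_int, ← integral_cos_int, ← intervalIntegral.integral_add
      (by apply Continuous.intervalIntegrable; fun_prop)
      (by apply Continuous.intervalIntegrable; fun_prop), ← intervalIntegral.integral_div]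
    congr 1
    ext x
    push_cast
    rw [sub_mul, sub_mul, add_mul, add_mul, Real.cos_sub, Real.cos_add]
    ring
  have hphi : ∀ k x, phiFun k x = (if k = 0 then 1 else √2) * Real.cos (k * Real.pi * x) := by
    intro k x
    unfold phiFun
    split_ifs with h <;> simp [h]
  have h2 : ∀ x, phiFun j x * phiFun k x
      = ((if j = 0 then 1 else √2) * (if k = 0 then 1 else √2))
        * (Real.cos (j * Real.pi * x) * Real.cos (k * Real.pi * x)) := by
    intro x
    rw [hphi, hphi]
    ring
  simp_rw [h2]
  rw [intervalIntegral.integral_const_mul, key]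
  have hs : √2 * √2 = 2 := Real.mul_self_sqrt (by norm_num)
  by_cases hjk : j = k
  · subst hjk
    by_cases hj : j = 0
    · simp [hj]
    · have : (j : ℤ) + j ≠ 0 := by omega
      simp [hj, hs, this]
  · have h1 : (j : ℤ) - k ≠ 0 := by omega
    have h3 : (j : ℤ) + k ≠ 0 := by omega
    simp [hjk, h1, h3]

lemma orthonormal_phi : Orthonormal ℂ phi := by
  rw [orthonormal_iff_ite]
  intro j k
  have h : inner ℂ (phi j) (phi k)
      = ∫ x, ((phiFun j x * phiFun k x : ℝ) : ℂ) ∂unitMeasure := by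
    rw [L2.inner_def]
    refine integral_congr_ae ?_
    filter_upwards [(memLp_phiFun j).coeFn_toLp, (memLp_phiFun k).coeFn_toLp] with x hj hk
    have hj' : (phi j : ℝ → ℂ) x = phiFun j x := hj
    have hk' : (phi k : ℝ → ℂ) x = phiFun k x := hk
    rw [hj', hk']
    simp [mul_comm]
  rw [h, integral_complex_ofReal, integral_Icc_eq_integral_Ioc,
    ← intervalIntegral.integral_of_le zero_le_one, integral_phiFun_mul]
  split_ifs <;> simp

/-! ### The Neumann heat operator `A₁` -/

/-- `⟨x, φ_k⟩`, linear in `x`. (Mathlib's inner product is linear in the second argument.) -/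
def coeff (k : ℕ) (x : L2) : ℂ := inner ℂ (phi k) x

lemma summable_iff_coeff (a : ℕ → ℂ) :
    Summable (fun k => a k • phi k) ↔ Summable (fun k => ‖a k‖ ^ 2) := by
  simpa using orthonormal_phi.orthogonalFamily.summable_iff_norm_sq_summable a

lemma summable_heat_iff (x : L2) :
    Summable (fun k : ℕ => ((k : ℂ) ^ 2 * (Real.pi : ℂ) ^ 2 * coeff k x) • phi k) ↔
      Summable (fun k : ℕ => (k : ℝ) ^ 4 * Real.pi ^ 4 * ‖coeff k x‖ ^ 2) := by
  rw [summable_iff_coeff]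
  refine summable_congr fun k => ?_
  simp only [norm_mul, norm_pow, Complex.norm_natCast, Complex.norm_real, Real.norm_eq_abs,
    abs_of_pos Real.pi_pos]
  ring

/-- `D(A₁) = {x : ∑ k⁴ π⁴ |⟨x, φ_k⟩|² < ∞}`. -/
def heatDomain : Submodule ℂ L2 where
  carrier := {x | Summable fun k : ℕ => (k : ℝ) ^ 4 * Real.pi ^ 4 * ‖coeff k x‖ ^ 2}
  zero_mem' := by simp [coeff]
  add_mem' := by
    intro x y hx hy
    rw [Set.mem_ofPred_eq, ← summable_heat_iff] at *
    refine (hx.add hy).congr fun k => ?_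
    simp [coeff, inner_add_right, mul_add, add_smul]
  smul_mem' := by
    intro c x hx
    rw [Set.mem_ofPred_eq, ← summable_heat_iff] at *
    refine (hx.const_smul c).congr fun k => ?_
    simp only [coeff, inner_smul_right, smul_smul]
    ring_nf

/-- `A₁ x = - ∑ k² π² ⟨x, φ_k⟩ φ_k` with domain `D(A₁)`; the series converges in `L²(0,1)`. -/
def heatOp : L2 →ₗ.[ℂ] L2 where
  domain := heatDomain
  toFun :=
    { toFun := fun x =>
        -∑' k : ℕ, ((k : ℂ) ^ 2 * (Real.pi : ℂ) ^ 2 * coeff k (x : L2)) • phi k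
      map_add' := by
        intro x y
        rw [← neg_add, ← ((summable_heat_iff _).2 x.2).tsum_add ((summable_heat_iff _).2 y.2)]
        simp [coeff, inner_add_right, mul_add, add_smul]
      map_smul' := by
        intro c x
        rw [RingHom.id_apply, smul_neg, ← ((summable_heat_iff _).2 x.2).tsum_const_smul c]
        congr 2
        ext1 k
        simp only [coeff, Submodule.coe_smul, inner_smul_right, smul_smul]
        ring_nf }

/-! ### The cascaded system -/

/-- The state space `X = L²(0,1) × ℂⁿ` with inner product `⟨x₁, y₁⟩ + ⟨x₂, y₂⟩`. -/
abbrev State (n : ℕ) : Type := WithLp 2 (L2 × EuclideanSpace ℂ (Fin n))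

/-- A real-valued function in `L²(0,1)`, regarded as complex-valued. -/
def complexify (g : Lp ℝ 2 unitMeasure) : L2 := Complex.ofRealCLM.compLp g

/-- `B₁ x₂ = b x₂ = ∑ i, x₂ i • b i`. -/
def B1 {n : ℕ} (b : Fin n → Lp ℝ 2 unitMeasure) : EuclideanSpace ℂ (Fin n) →L[ℂ] L2 :=
  ∑ i, (EuclideanSpace.proj i : EuclideanSpace ℂ (Fin n) →L[ℂ] ℂ).smulRight (complexify (b i))

/-- The bounded operator `ℂᵏ → ℂˡ` given by a complex matrix. -/
def matOp {k l : ℕ} (M : Matrix (Fin l) (Fin k) ℂ) :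
    EuclideanSpace ℂ (Fin k) →L[ℂ] EuclideanSpace ℂ (Fin l) :=
  (Matrix.toLpLin 2 2 M).toContinuousLinearMap

/-- A real matrix regarded as a complex one. -/
abbrev toC {k l : ℕ} (M : Matrix (Fin l) (Fin k) ℝ) : Matrix (Fin l) (Fin k) ℂ :=
  M.map Complex.ofReal

/-- `A = [A₁ B₁; 0 G]` with domain `D(A₁) × ℂⁿ`. -/
def sysOp {n : ℕ} (b : Fin n → Lp ℝ 2 unitMeasure) (G : Matrix (Fin n) (Fin n) ℝ) :
    State n →ₗ.[ℂ] State n where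
  domain := heatOp.domain.comap (WithLp.fstL 2 ℂ L2 (EuclideanSpace ℂ (Fin n))).toLinearMap
  toFun :=
    { toFun := fun x => WithLp.toLp 2
        (heatOp ⟨(x : State n).fst, x.2⟩ + B1 b (x : State n).snd,
          matOp (toC G) (x : State n).snd)
      map_add' := by
        intro x y
        have h : heatOp ⟨((x + y : _) : State n).fst, (x + y).2⟩
            = heatOp ⟨(x : State n).fst, x.2⟩ + heatOp ⟨(y : State n).fst, y.2⟩ := by
          rw [← LinearPMap.map_add]
          rfl
        rw [h, ← WithLp.toLp_add]
        congr 1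
        ext1
        · simp only [Submodule.coe_add, WithLp.add_snd, map_add, Prod.mk_add_mk]
          abel
        · simp
      map_smul' := by
        intro c x
        have h : heatOp ⟨((c • x : _) : State n).fst, (c • x).2⟩
            = c • heatOp ⟨(x : State n).fst, x.2⟩ := by
          rw [← LinearPMap.map_smul]
          rfl
        rw [h, RingHom.id_apply, ← WithLp.toLp_smul]
        congr 1
        ext1 <;> simp }

/-- `B = [0; H]`. -/
def ctrlOp {n m : ℕ} (H : Matrix (Fin n) (Fin m) ℝ) :
    EuclideanSpace ℂ (Fin m) →L[ℂ] State n :=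
  (WithLp.prodContinuousLinearEquiv 2 ℂ L2 (EuclideanSpace ℂ (Fin n))).symm.toContinuousLinearMap
    ∘L ((0 : EuclideanSpace ℂ (Fin m) →L[ℂ] L2).prod (matOp (toC H)))

/-- `F = [F₁ F₂]`. -/
def feedbackOp {n m : ℕ} (F1 : L2 →L[ℂ] EuclideanSpace ℂ (Fin m))
    (F2 : Matrix (Fin m) (Fin n) ℂ) : State n →L[ℂ] EuclideanSpace ℂ (Fin m) :=
  F1 ∘L WithLp.fstL 2 ℂ L2 (EuclideanSpace ℂ (Fin n)) +
    matOp F2 ∘L WithLp.sndL 2 ℂ L2 (EuclideanSpace ℂ (Fin n))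

/-- `A + BF` with domain `D(A)`. -/
def closedLoopOp {n m : ℕ} (b : Fin n → Lp ℝ 2 unitMeasure) (G : Matrix (Fin n) (Fin n) ℝ)
    (H : Matrix (Fin n) (Fin m) ℝ) (F1 : L2 →L[ℂ] EuclideanSpace ℂ (Fin m))
    (F2 : Matrix (Fin m) (Fin n) ℂ) : State n →ₗ.[ℂ] State n :=
  (ctrlOp H ∘L feedbackOp F1 F2).toLinearMap +ᵥ sysOp b G

/-! ### The transfer functions -/

/-- The row vector `B⁺ = [⟨b₁, φ₀⟩ ⋯ ⟨bₙ, φ₀⟩]`. -/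
def BPlus {n : ℕ} (b : Fin n → Lp ℝ 2 unitMeasure) : Fin n → ℂ :=
  fun i => coeff 0 (complexify (b i))

/-- `G₂(λ) = (λ I - G - H F₂)⁻¹`, a matrix of rational functions. -/
def transfer2 {n m : ℕ} (G : Matrix (Fin n) (Fin n) ℝ) (H : Matrix (Fin n) (Fin m) ℝ)
    (F2 : Matrix (Fin m) (Fin n) ℂ) : Matrix (Fin n) (Fin n) (RatFunc ℂ) :=
  (Matrix.scalar (Fin n) RatFunc.X - (toC G).map RatFunc.C - (toC H * F2).map RatFunc.C)⁻¹

/-- `G₁(λ) = (λ - B⁺ (λ I - G - H F₂)⁻¹ H f)⁻¹`, a rational function. -/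
def transfer1 {n m : ℕ} (b : Fin n → Lp ℝ 2 unitMeasure) (G : Matrix (Fin n) (Fin n) ℝ)
    (H : Matrix (Fin n) (Fin m) ℝ) (f : EuclideanSpace ℂ (Fin m))
    (F2 : Matrix (Fin m) (Fin n) ℂ) : RatFunc ℂ :=
  (RatFunc.X - (fun i => RatFunc.C (BPlus b i)) ⬝ᵥ
    (transfer2 G H F2).mulVec (fun i => RatFunc.C ((toC H).mulVec f i)))⁻¹

end HeatODE

end

noncomputable section

namespace HeatODE

/-! ### Completeness of the cosine system -/

/-! The feedback sees the temperature only through its mean, and the heat flow does not mix cosine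
modes. Hence the pair (mean, z₂) obeys a closed linear equation on ℂ × ℂⁿ, with the matrix (a, v) ↦
(B⁺v, a Hf + (G + HF₂)v) (`slowOp`), while the zero-mean part of the temperature is a heat flow
decaying like e^{-π²t}, forced by that finite-dimensional system.

Variation of constants then gives the closed-loop semigroup explicitly (`cascadeOp`), so no
perturbation theorem is needed. Its difference quotients split into a slow, a forced and a heat
part. The first two always converge, and the third converges exactly on D(A₁), so the generator is A
+ BF with the correct domain (`tendsto_cascade_quotient_iff`, `isGeneratedBy_closedLoopOp`). This
rests on completeness of the cosines (`phiBasis`), which turns L² questions into questions about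
square-summable coefficients.

For stability, an eigenvector (a, v) of `slowOp` at z with Re z ≥ 0 satisfies v = a (z - G -
HF₂)⁻¹Hf by its second row, and then a/G₁(z) = 0 by its first; regularity of both transfer functions
at z forces a = 0 and v = 0 (`slowOp_eigenvalue_re_neg`). So the matrix exponential decays, and the
forced heat flow decays with it (`exists_norm_cascadeOp_le`).

Two points remain. The growth bound must exist as a limit: this is Fekete's argument, with the mode
φ₁ keeping the logarithms bounded below (`exp_le_norm_cascadeOp`). And stability is claimed for
every semigroup with the given generator, so uniqueness is proved mode by mode
(`op_eq_of_isGeneratedBy`). -/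

lemma integrable_mul_of_continuous {g : ℝ → ℝ} (hg : Continuous g) (x : L2) :
    Integrable (fun ξ => (g ξ : ℂ) * x ξ) unitMeasure := by
  have hx : Integrable (x : ℝ → ℂ) unitMeasure :=
    (Lp.memLp x).integrable (by norm_num)
  obtain ⟨C, hC⟩ := (isCompact_Icc (a := (0 : ℝ)) (b := 1)).exists_bound_of_continuousOn
    hg.continuousOn
  refine hx.bdd_mul (c := C)
    (Complex.continuous_ofReal.comp hg).aestronglyMeasurable ?_
  filter_upwards [ae_restrict_mem measurableSet_Icc] with ξ hξ
  simpa [Complex.norm_real] using hC ξ hξ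

lemma integral_cos_mul_eq_zero {x : L2} (h : ∀ k, coeff k x = 0) (k : ℕ) :
    ∫ ξ, (Real.cos (k * Real.pi * ξ) : ℂ) * x ξ ∂unitMeasure = 0 := by
  have h1 := h k
  rw [coeff, L2.inner_def] at h1
  have h2 : ∫ ξ, (phiFun k ξ : ℂ) * x ξ ∂unitMeasure = 0 := by
    rw [← h1]
    refine integral_congr_ae ?_
    filter_upwards [(memLp_phiFun k).coeFn_toLp] with ξ hk
    have hk' : (phi k : ℝ → ℂ) ξ = phiFun k ξ := hk
    simp [hk', mul_comm]
  by_cases hk : k = 0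
  · subst hk
    simpa [phiFun] using h2
  · have h3 : ∀ ξ, (phiFun k ξ : ℂ) * x ξ
        = ((√2 : ℝ) : ℂ) * ((Real.cos (k * Real.pi * ξ) : ℂ) * x ξ) := by
      intro ξ
      simp only [phiFun, hk, if_false, Complex.ofReal_mul]
      ring
    simp_rw [h3] at h2
    rw [integral_const_mul] at h2
    exact (mul_eq_zero.1 h2).resolve_left (by simp)

/-- Induction on the power, for all frequencies at once: cos(πξ) cos((k+1)πξ) is the mean of
cos((k+2)πξ) and cos(kπξ). At frequency 0 the extra factor is itself the cosine of frequency 1. -/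
lemma integral_cos_pow_mul_eq_zero {x : L2} (h : ∀ k, coeff k x = 0) (j : ℕ) : ∀ k : ℕ,
    ∫ ξ, ((Real.cos (Real.pi * ξ) ^ j * Real.cos (k * Real.pi * ξ) : ℝ) : ℂ) * x ξ
      ∂unitMeasure = 0 := by
  induction j with
  | zero => intro k; simpa using integral_cos_mul_eq_zero h k
  | succ j ih =>
    intro k
    rcases k with _ | k
    · have := ih 1
      simpa [pow_succ] using this
    · have h3 : ∀ ξ : ℝ, ((Real.cos (Real.pi * ξ) ^ (j + 1) *
            Real.cos (((k + 1 : ℕ) : ℝ) * Real.pi * ξ) : ℝ) : ℂ) * x ξ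
          = (1 / 2 : ℂ) * (((Real.cos (Real.pi * ξ) ^ j *
              Real.cos (((k + 2 : ℕ) : ℝ) * Real.pi * ξ) : ℝ) : ℂ) * x ξ
            + ((Real.cos (Real.pi * ξ) ^ j *
              Real.cos ((k : ℝ) * Real.pi * ξ) : ℝ) : ℂ) * x ξ) := by
        intro ξ
        have e1 : ((k + 2 : ℕ) : ℝ) * Real.pi * ξ
            = ((k + 1 : ℕ) : ℝ) * Real.pi * ξ + Real.pi * ξ := by push_cast; ring
        have e2 : (k : ℝ) * Real.pi * ξ
            = ((k + 1 : ℕ) : ℝ) * Real.pi * ξ - Real.pi * ξ := by push_cast; ring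
        rw [e1, e2, Real.cos_add, Real.cos_sub]
        push_cast
        ring
      simp_rw [h3]
      rw [integral_const_mul, integral_add, ih, ih]
      · simp
      · exact integrable_mul_of_continuous (by fun_prop) x
      · exact integrable_mul_of_continuous (by fun_prop) x

lemma integral_polynomial_cos_mul_eq_zero {x : L2} (h : ∀ k, coeff k x = 0)
    (p : Polynomial ℝ) :
    ∫ ξ, ((p.eval (Real.cos (Real.pi * ξ)) : ℝ) : ℂ) * x ξ ∂unitMeasure = 0 := by
  simp_rw [Polynomial.eval_eq_sum_range, Complex.ofReal_sum, Finset.sum_mul]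
  rw [integral_finsetSum]
  · refine Finset.sum_eq_zero fun i _ => ?_
    have h3 : ∀ ξ : ℝ, ((p.coeff i * Real.cos (Real.pi * ξ) ^ i : ℝ) : ℂ) * x ξ
        = (p.coeff i : ℂ) * (((Real.cos (Real.pi * ξ) ^ i *
          Real.cos ((0 : ℕ) * Real.pi * ξ) : ℝ) : ℂ) * x ξ) := by
      intro ξ
      simp [mul_assoc]
    simp_rw [h3]
    rw [integral_const_mul, integral_cos_pow_mul_eq_zero h, mul_zero]
  · intro i _
    exact integrable_mul_of_continuous (by fun_prop) x

/-- The map ξ ↦ cos(πξ) carries [0,1] bijectively onto [-1,1], so by Weierstrass a continuous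
function on [0,1] is a uniform limit of polynomials in cos(πξ). -/
lemma integral_continuous_mul_eq_zero {x : L2} (h : ∀ k, coeff k x = 0) {g : ℝ → ℝ}
    (hg : Continuous g) : ∫ ξ, (g ξ : ℂ) * x ξ ∂unitMeasure = 0 := by
  have hx : Integrable (x : ℝ → ℂ) unitMeasure := (Lp.memLp x).integrable (by norm_num)
  rw [← norm_le_zero_iff]
  refine le_of_forall_pos_le_add fun ε hε => ?_
  set C := ∫ ξ, ‖x ξ‖ ∂unitMeasure with hC
  have hC0 : 0 ≤ C := integral_nonneg fun _ => norm_nonneg _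
  obtain ⟨p, hp⟩ := exists_polynomial_near_of_continuousOn (-1) 1
    (fun y => g (Real.arccos y / Real.pi))
    (hg.comp (Real.continuous_arccos.div_const _)).continuousOn (ε / (C + 1)) (by positivity)
  have h1 : ∫ ξ, (g ξ : ℂ) * x ξ ∂unitMeasure
      = ∫ ξ, ((g ξ - p.eval (Real.cos (Real.pi * ξ)) : ℝ) : ℂ) * x ξ ∂unitMeasure := by
    have : ∀ ξ, ((g ξ - p.eval (Real.cos (Real.pi * ξ)) : ℝ) : ℂ) * x ξ
        = (g ξ : ℂ) * x ξ - ((p.eval (Real.cos (Real.pi * ξ)) : ℝ) : ℂ) * x ξ := by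
      intro ξ; push_cast; ring
    simp_rw [this]
    rw [integral_sub (integrable_mul_of_continuous hg x)
      (integrable_mul_of_continuous (by fun_prop) x),
      integral_polynomial_cos_mul_eq_zero h, sub_zero]
  rw [h1, zero_add]
  calc ‖∫ ξ, ((g ξ - p.eval (Real.cos (Real.pi * ξ)) : ℝ) : ℂ) * x ξ ∂unitMeasure‖
      ≤ ∫ ξ, ε / (C + 1) * ‖x ξ‖ ∂unitMeasure := by
        refine norm_integral_le_of_norm_le (hx.norm.const_mul _) ?_
        filter_upwards [ae_restrict_mem measurableSet_Icc] with ξ hξ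
        rw [norm_mul, Complex.norm_real]
        refine mul_le_mul_of_nonneg_right ?_ (norm_nonneg _)
        have h2 := hp (Real.cos (Real.pi * ξ)) ⟨Real.neg_one_le_cos _, Real.cos_le_one _⟩
        rw [Real.arccos_cos (mul_nonneg Real.pi_pos.le hξ.1)
          (mul_le_of_le_one_right Real.pi_pos.le hξ.2),
          mul_div_cancel_left₀ _ Real.pi_ne_zero] at h2
        rw [Real.norm_eq_abs, abs_sub_comm]
        exact h2.le
    _ = ε * (C / (C + 1)) := by rw [integral_const_mul, ← hC]; ring
    _ ≤ ε := mul_le_of_le_one_right hε.le (by rw [div_le_one (by positivity)]; linarith)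

lemma eq_zero_of_coeff_eq_zero {x : L2} (h : ∀ k, coeff k x = 0) : x = 0 := by
  have hx : Integrable (x : ℝ → ℂ) unitMeasure := (Lp.memLp x).integrable (by norm_num)
  rw [Lp.eq_zero_iff_ae_eq_zero]
  refine ae_eq_zero_of_integral_contDiff_smul_eq_zero hx.locallyIntegrable fun g hg _ => ?_
  simpa [Complex.real_smul] using integral_continuous_mul_eq_zero h hg.continuous

lemma ext_coeff {x y : L2} (h : ∀ k, coeff k x = coeff k y) : x = y := by
  rw [← sub_eq_zero]
  refine eq_zero_of_coeff_eq_zero fun k => ?_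
  have := h k
  simp only [coeff, inner_sub_right] at *
  rw [this, sub_self]

/-- The cosines form a Hilbert basis of `L²(0,1)`. -/
def phiBasis : HilbertBasis ℕ ℂ L2 :=
  HilbertBasis.mkOfOrthogonalEqBot orthonormal_phi <| by
    rw [Submodule.eq_bot_iff]
    intro x hx
    refine eq_zero_of_coeff_eq_zero fun k => ?_
    exact (Submodule.mem_orthogonal _ _).1 hx _ (Submodule.subset_span ⟨k, rfl⟩)

@[simp] lemma phiBasis_apply (k : ℕ) : phiBasis k = phi k := by
  simp [phiBasis]

/-- Parseval's identity, through which all later norm estimates and limits in L² are reduced to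
coefficients. -/
lemma hasSum_norm_coeff_sq (x : L2) : HasSum (fun k => ‖coeff k x‖ ^ 2) (‖x‖ ^ 2) := by
  have h := phiBasis.hasSum_inner_mul_inner x x
  rw [inner_self_eq_norm_sq_to_K] at h
  have h2 := (RCLike.reCLM (K := ℂ)).hasSum h
  have e1 : (fun k => ‖coeff k x‖ ^ 2) =
      fun k => RCLike.reCLM (inner ℂ x (phiBasis k) * inner ℂ (phiBasis k) x) := by
    funext k
    rw [phiBasis_apply, ← inner_conj_symm x (phi k), RCLike.conj_mul]
    simp only [RCLike.reCLM_apply, coeff]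
    norm_cast
  have e2 : ‖x‖ ^ 2 = RCLike.reCLM ((‖x‖ : ℂ) ^ 2) := by
    simp only [RCLike.reCLM_apply]
    norm_cast
  rw [e1, e2]
  exact h2

lemma coeff_phi (j k : ℕ) : coeff j (phi k) = if j = k then 1 else 0 :=
  orthonormal_iff_ite.1 orthonormal_phi j k

/-- `coeff k` as a bounded functional. -/
def coeffL (k : ℕ) : L2 →L[ℂ] ℂ := innerSL ℂ (phi k)

@[simp] lemma coeffL_apply (k : ℕ) (x : L2) : coeffL k x = coeff k x := rfl

lemma coeff_hasSum {a : ℕ → ℂ} {x : L2} (h : HasSum (fun k => a k • phi k) x) (j : ℕ) :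
    coeff j x = a j := by
  have h1 := (coeffL j).hasSum h
  have h2 : HasSum (fun k => coeffL j (a k • phi k)) (a j) := by
    convert hasSum_ite_eq j (a j) using 1
    ext k
    simp only [map_smul, coeffL_apply, coeff_phi, smul_eq_mul, mul_ite, mul_one, mul_zero]
    by_cases hk : j = k
    · simp [hk]
    · simp [hk, Ne.symm hk]
  exact h1.unique h2

end HeatODE

/-- Generators are defined with times in `ℝ≥0`, whereas derivatives and integrals live on `ℝ`; this
passes between the two. -/
lemma tendsto_nhdsGT_coe_iff {α : Type*} {F : ℝ → α} {l : Filter α} :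
    Tendsto (fun h : ℝ≥0 => F h) (𝓝[>] 0) l ↔ Tendsto F (𝓝[>] (0 : ℝ)) l := by
  constructor
  · intro h
    have h1 : Tendsto Real.toNNReal (𝓝[>] (0 : ℝ)) (𝓝[>] 0) := by
      refine tendsto_nhdsWithin_iff.2 ⟨?_, ?_⟩
      · have := (continuous_real_toNNReal.tendsto 0)
        rw [Real.toNNReal_zero] at this
        exact this.mono_left nhdsWithin_le_nhds
      · filter_upwards [self_mem_nhdsWithin] with t ht
        exact Real.toNNReal_pos.2 ht
    refine (h.comp h1).congr' ?_
    filter_upwards [self_mem_nhdsWithin] with t ht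
    simp only [Function.comp, Real.coe_toNNReal t (le_of_lt ht)]
  · intro h
    refine h.comp (tendsto_nhdsWithin_iff.2 ⟨?_, ?_⟩)
    · exact (NNReal.continuous_coe.tendsto 0).mono_left nhdsWithin_le_nhds
    · filter_upwards [self_mem_nhdsWithin] with t ht
      exact NNReal.coe_pos.2 ht

namespace HeatODE

/-! ### Diagonal operators -/

@[simp] lemma coeff_add (k : ℕ) (x y : L2) : coeff k (x + y) = coeff k x + coeff k y :=
  (coeffL k).map_add x y

@[simp] lemma coeff_sub (k : ℕ) (x y : L2) : coeff k (x - y) = coeff k x - coeff k y :=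
  (coeffL k).map_sub x y

@[simp] lemma coeff_smul (k : ℕ) (c : ℂ) (x : L2) : coeff k (c • x) = c * coeff k x :=
  (coeffL k).map_smul c x

lemma norm_le_of_coeff_le {x y : L2} {C : ℝ} (hC : 0 ≤ C)
    (h : ∀ k, ‖coeff k y‖ ≤ C * ‖coeff k x‖) : ‖y‖ ≤ C * ‖x‖ := by
  refine le_of_sq_le_sq ?_ (by positivity)
  rw [mul_pow]
  refine hasSum_le (fun k => ?_) (hasSum_norm_coeff_sq y)
    ((hasSum_norm_coeff_sq x).mul_left (C ^ 2))
  rw [← mul_pow]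
  exact pow_le_pow_left₀ (norm_nonneg _) (h k) 2

lemma summable_smul_phi {a : ℕ → ℂ} {C : ℝ} (ha : ∀ k, ‖a k‖ ≤ C) (x : L2) :
    Summable fun k => (a k * coeff k x) • phi k := by
  rw [summable_iff_coeff]
  refine Summable.of_nonneg_of_le (fun k => by positivity) (fun k => ?_)
    ((hasSum_norm_coeff_sq x).summable.mul_left (C ^ 2))
  rw [norm_mul, mul_pow]
  exact mul_le_mul_of_nonneg_right (pow_le_pow_left₀ (norm_nonneg _) (ha k) 2) (by positivity)

/-- The operator acting by multiplication with `a k` on the `k`-th coefficient. -/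
def diagOp (a : ℕ → ℂ) (C : ℝ) (ha : ∀ k, ‖a k‖ ≤ C) : L2 →L[ℂ] L2 :=
  LinearMap.mkContinuous
    { toFun := fun x => ∑' k, (a k * coeff k x) • phi k
      map_add' := by
        intro x y
        rw [← (summable_smul_phi ha x).tsum_add (summable_smul_phi ha y)]
        simp [mul_add, add_smul]
      map_smul' := by
        intro c x
        rw [RingHom.id_apply, ← (summable_smul_phi ha x).tsum_const_smul c]
        congr 1
        ext1 k
        rw [coeff_smul, smul_smul]
        ring_nf }
    C (by
      intro x
      refine norm_le_of_coeff_le ((norm_nonneg _).trans (ha 0)) fun k => ?_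
      rw [LinearMap.coe_mk, AddHom.coe_mk, coeff_hasSum (summable_smul_phi ha x).hasSum, norm_mul]
      exact mul_le_mul_of_nonneg_right (ha k) (norm_nonneg _))

@[simp] lemma coeff_diagOp {a : ℕ → ℂ} {C : ℝ} (ha : ∀ k, ‖a k‖ ≤ C) (x : L2) (k : ℕ) :
    coeff k (diagOp a C ha x) = a k * coeff k x :=
  coeff_hasSum (summable_smul_phi ha x).hasSum k

/-- Dominated convergence for the Parseval series of the difference. -/
lemma tendsto_of_coeff {α : Type*} {l : Filter α} {y : α → L2} {y₀ : L2} {bound : ℕ → ℝ}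
    (hb : Summable bound) (h : ∀ k, Tendsto (fun a => coeff k (y a)) l (𝓝 (coeff k y₀)))
    (hle : ∀ᶠ a in l, ∀ k, ‖coeff k (y a) - coeff k y₀‖ ^ 2 ≤ bound k) :
    Tendsto y l (𝓝 y₀) := by
  rw [tendsto_iff_norm_sub_tendsto_zero]
  have h1 : Tendsto (fun a => ∑' k, ‖coeff k (y a) - coeff k y₀‖ ^ 2) l (𝓝 (∑' _ : ℕ, (0 : ℝ))) := by
    refine tendsto_tsum_of_dominated_convergence hb (fun k => ?_) ?_
    · have := ((h k).sub_const (coeff k y₀)).norm.pow 2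
      simpa using this
    · filter_upwards [hle] with a ha k
      rw [Real.norm_of_nonneg (by positivity)]
      exact ha k
  have h2 : (fun a => ∑' k, ‖coeff k (y a) - coeff k y₀‖ ^ 2) = fun a => ‖y a - y₀‖ ^ 2 := by
    funext a
    rw [← (hasSum_norm_coeff_sq (y a - y₀)).tsum_eq]
    simp
  rw [h2, tsum_zero] at h1
  have h3 := h1.sqrt
  simpa [Real.sqrt_sq (norm_nonneg _)] using h3

/-! ### The heat semigroup on the orthogonal complement of the constants -/

/-- The eigenvalue `k² π²` of the negative Neumann Laplacian. -/
def lam (k : ℕ) : ℝ := (k : ℝ) ^ 2 * Real.pi ^ 2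

lemma lam_nonneg (k : ℕ) : 0 ≤ lam k := by unfold lam; positivity

lemma lam_zero : lam 0 = 0 := by simp [lam]

lemma pi_sq_le_lam {k : ℕ} (hk : k ≠ 0) : Real.pi ^ 2 ≤ lam k := by
  have : (1 : ℝ) ≤ k := by exact_mod_cast Nat.one_le_iff_ne_zero.2 hk
  unfold lam
  nlinarith [one_le_pow₀ this (n := 2), sq_nonneg Real.pi]

/-- The multipliers of the heat semigroup, with the constant mode removed. -/
def heatWeight (t : ℝ) (k : ℕ) : ℂ := if k = 0 then 0 else (Real.exp (-lam k * max t 0) : ℝ)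

lemma norm_heatWeight_le_exp (t : ℝ) (k : ℕ) :
    ‖heatWeight t k‖ ≤ Real.exp (-Real.pi ^ 2 * max t 0) := by
  unfold heatWeight
  split_ifs with hk
  · simpa using Real.exp_nonneg _
  · rw [Complex.norm_real, Real.norm_of_nonneg (Real.exp_nonneg _), Real.exp_le_exp]
    nlinarith [pi_sq_le_lam hk, le_max_right t 0]

lemma norm_heatWeight_le_one (t : ℝ) (k : ℕ) : ‖heatWeight t k‖ ≤ 1 := by
  refine (norm_heatWeight_le_exp t k).trans (Real.exp_le_one_iff.2 ?_)
  nlinarith [le_max_right t 0, sq_nonneg Real.pi]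

/-- The heat semigroup composed with the projection onto the complement of the constants; for
`t ≤ 0` it is this projection. -/
def heatPlus (t : ℝ) : L2 →L[ℂ] L2 := diagOp (heatWeight t) 1 (norm_heatWeight_le_one t)

@[simp] lemma coeff_heatPlus (t : ℝ) (x : L2) (k : ℕ) :
    coeff k (heatPlus t x) = heatWeight t k * coeff k x := coeff_diagOp _ _ _

lemma norm_heatPlus_apply_le {t : ℝ} (ht : 0 ≤ t) (x : L2) :
    ‖heatPlus t x‖ ≤ Real.exp (-Real.pi ^ 2 * t) * ‖x‖ := by
  refine norm_le_of_coeff_le (Real.exp_nonneg _) fun k => ?_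
  rw [coeff_heatPlus, norm_mul]
  have := norm_heatWeight_le_exp t k
  rw [max_eq_left ht] at this
  exact mul_le_mul_of_nonneg_right this (norm_nonneg _)

lemma norm_heatPlus_apply_le_norm (t : ℝ) (x : L2) : ‖heatPlus t x‖ ≤ ‖x‖ := by
  rw [← one_mul ‖x‖]
  refine norm_le_of_coeff_le zero_le_one fun k => ?_
  rw [coeff_heatPlus, norm_mul]
  exact mul_le_mul_of_nonneg_right (norm_heatWeight_le_one t k) (norm_nonneg _)

lemma heatWeight_add {s t : ℝ} (hs : 0 ≤ s) (ht : 0 ≤ t) (k : ℕ) :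
    heatWeight (s + t) k = heatWeight s k * heatWeight t k := by
  unfold heatWeight
  split_ifs
  · simp
  · rw [max_eq_left hs, max_eq_left ht, max_eq_left (add_nonneg hs ht), ← Complex.ofReal_mul,
      ← Real.exp_add]
    ring_nf

lemma heatPlus_add {s t : ℝ} (hs : 0 ≤ s) (ht : 0 ≤ t) (x : L2) :
    heatPlus s (heatPlus t x) = heatPlus (s + t) x :=
  ext_coeff fun k => by simp only [coeff_heatPlus, heatWeight_add hs ht, mul_assoc]

@[simp] lemma heatPlus_phi_zero (t : ℝ) : heatPlus t (phi 0) = 0 := by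
  refine eq_zero_of_coeff_eq_zero fun k => ?_
  rw [coeff_heatPlus, coeff_phi]
  by_cases hk : k = 0 <;> simp [hk, heatWeight]

@[simp] lemma coeff_zero_heatPlus (t : ℝ) (x : L2) : coeff 0 (heatPlus t x) = 0 := by
  simp [heatWeight]

lemma heatPlus_zero (x : L2) : heatPlus 0 x = x - coeff 0 x • phi 0 := by
  refine ext_coeff fun k => ?_
  rw [coeff_heatPlus, coeff_sub, coeff_smul, coeff_phi]
  by_cases hk : k = 0
  · simp [hk, heatWeight]
  · simp [hk, heatWeight]

lemma continuous_heatPlus_apply (x : L2) : Continuous fun t => heatPlus t x := by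
  rw [continuous_iff_continuousAt]
  intro t
  refine tendsto_of_coeff (bound := fun k => 4 * ‖coeff k x‖ ^ 2)
    ((hasSum_norm_coeff_sq x).summable.mul_left 4) (fun k => ?_) (Eventually.of_forall fun s k => ?_)
  · simp only [coeff_heatPlus]
    refine Tendsto.mul_const _ ?_
    have : Continuous fun t => heatWeight t k := by
      unfold heatWeight
      split_ifs <;> fun_prop
    exact this.tendsto t
  · simp only [coeff_heatPlus]
    rw [← sub_mul, norm_mul, mul_pow]
    refine mul_le_mul_of_nonneg_right ?_ (by positivity)
    have h1 := norm_sub_le (heatWeight s k) (heatWeight t k)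
    have h2 := norm_heatWeight_le_one s k
    have h3 := norm_heatWeight_le_one t k
    have h4 := norm_nonneg (heatWeight s k - heatWeight t k)
    nlinarith

/-- Strong continuity together with the uniform bound 1. Truncating at negative times makes this
hold on all of ℝ, which later gives a forcing integrand continuous on the whole (t, s)-plane. -/
lemma continuous_heatPlus_uncurry : Continuous fun p : ℝ × L2 => heatPlus p.1 p.2 := by
  rw [continuous_iff_continuousAt]
  rintro ⟨t, x⟩
  rw [ContinuousAt, tendsto_iff_norm_sub_tendsto_zero]
  have h1 : Tendsto (fun p : ℝ × L2 => ‖p.2 - x‖ + ‖heatPlus p.1 x - heatPlus t x‖) (𝓝 (t, x))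
      (𝓝 0) := by
    have hc : Continuous fun p : ℝ × L2 => ‖p.2 - x‖ + ‖heatPlus p.1 x - heatPlus t x‖ := by
      have := (continuous_heatPlus_apply x).comp (continuous_fst (X := ℝ) (Y := L2))
      simp only [Function.comp_def] at this
      fun_prop
    simpa using hc.tendsto (t, x)
  refine squeeze_zero (fun _ => norm_nonneg _) (fun p => ?_) h1
  have h2 : heatPlus p.1 p.2 - heatPlus t x
      = heatPlus p.1 (p.2 - x) + (heatPlus p.1 x - heatPlus t x) := by
    rw [map_sub]; abel
  rw [h2]
  exact (norm_add_le _ _).trans (by gcongr; exact norm_heatPlus_apply_le_norm _ _)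

/-! ### The generator of the heat flow on zero-mean functions -/

lemma mem_heatDomain_iff (x : L2) :
    x ∈ heatDomain ↔ Summable fun k => (lam k) ^ 2 * ‖coeff k x‖ ^ 2 := by
  change Summable _ ↔ _
  refine summable_congr fun k => ?_
  unfold lam
  ring

lemma coeff_heatOp (x : heatOp.domain) (k : ℕ) :
    coeff k (heatOp x) = -lam k * coeff k (x : L2) := by
  have h := coeff_hasSum (((summable_heat_iff (x : L2)).2 x.2).hasSum) k
  have h2 : heatOp x
      = -∑' k : ℕ, ((k : ℂ) ^ 2 * (Real.pi : ℂ) ^ 2 * coeff k (x : L2)) • phi k := rfl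
  rw [h2, ← coeffL_apply, map_neg, coeffL_apply, h, lam]
  push_cast
  ring

/-- From 1 - lh ≤ e^{-lh} ≤ 1. It supplies the dominating sequence for the heat difference
quotients. -/
lemma abs_exp_neg_sub_one_div_le {l h : ℝ} (hl : 0 ≤ l) (hh : 0 < h) :
    |h⁻¹ * (Real.exp (-l * h) - 1)| ≤ l := by
  have h1 : Real.exp (-l * h) ≤ 1 := Real.exp_le_one_iff.2 (by nlinarith)
  have h2 := Real.add_one_le_exp (-l * h)
  rw [abs_le]
  constructor
  · rw [← neg_le_neg_iff, neg_neg, ← mul_neg, inv_mul_le_iff₀ hh]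
    nlinarith
  · exact (mul_nonpos_of_nonneg_of_nonpos (inv_nonneg.2 hh.le) (by linarith)).trans hl

lemma coeff_heatPlus_quotient {h : ℝ} (hh : 0 < h) (x : L2) (k : ℕ) :
    coeff k ((h : ℂ)⁻¹ • (heatPlus h x - heatPlus 0 x))
      = ((h⁻¹ * (Real.exp (-lam k * h) - 1) : ℝ) : ℂ) * coeff k x := by
  simp only [coeff_smul, coeff_sub, coeff_heatPlus]
  by_cases hk : k = 0
  · simp [hk, heatWeight, lam_zero]
  · simp only [heatWeight, hk, if_false, max_eq_left hh.le]
    simp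
    ring

lemma tendsto_exp_quotient (l : ℝ) :
    Tendsto (fun h : ℝ => h⁻¹ * (Real.exp (-l * h) - 1)) (𝓝[>] 0) (𝓝 (-l)) := by
  have h1 : HasDerivAt (fun h : ℝ => Real.exp (-l * h)) (-l) 0 := by
    have := ((hasDerivAt_id (0 : ℝ)).const_mul (-l)).exp
    simpa using this
  have h2 := h1.tendsto_slope.mono_left (nhdsWithin_mono (0 : ℝ)
    (fun x (hx : 0 < x) => (ne_of_gt hx : x ≠ 0)))
  refine h2.congr fun h => ?_
  simp [slope_def_field, div_eq_inv_mul]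

lemma tendsto_coeff_heatPlus_quotient (x : L2) (k : ℕ) :
    Tendsto (fun h : ℝ => coeff k ((h : ℂ)⁻¹ • (heatPlus h x - heatPlus 0 x))) (𝓝[>] 0)
      (𝓝 (-lam k * coeff k x)) := by
  have h1 := ((Complex.continuous_ofReal.tendsto _).comp (tendsto_exp_quotient (lam k))).mul_const
    (coeff k x)
  rw [Complex.ofReal_neg] at h1
  refine h1.congr' ?_
  filter_upwards [self_mem_nhdsWithin] with h hh
  rw [coeff_heatPlus_quotient hh]
  rfl

lemma tendsto_heatPlus_quotient (x : heatOp.domain) :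
    Tendsto (fun h : ℝ => (h : ℂ)⁻¹ • (heatPlus h (x : L2) - heatPlus 0 (x : L2))) (𝓝[>] 0)
      (𝓝 (heatOp x)) := by
  refine tendsto_of_coeff (bound := fun k => 4 * ((lam k) ^ 2 * ‖coeff k (x : L2)‖ ^ 2))
    (((mem_heatDomain_iff _).1 x.2).mul_left 4) (fun k => ?_) ?_
  · rw [coeff_heatOp]
    exact tendsto_coeff_heatPlus_quotient _ k
  · filter_upwards [self_mem_nhdsWithin] with h hh k
    rw [coeff_heatPlus_quotient hh, coeff_heatOp, ← sub_mul, norm_mul, mul_pow, ← mul_assoc]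
    refine mul_le_mul_of_nonneg_right ?_ (by positivity)
    rw [← Complex.ofReal_neg, ← Complex.ofReal_sub, Complex.norm_real, Real.norm_eq_abs, sq_abs]
    have h1 := abs_le.1 (abs_exp_neg_sub_one_div_le (lam_nonneg k) hh)
    nlinarith [lam_nonneg k]

/-- The coefficients of the limit must be -λ_k times those of x, and they are square-summable
because the limit lies in L². Hence the generator has no larger domain than D(A₁). -/
lemma mem_heatDomain_of_tendsto {x z : L2}
    (hz : Tendsto (fun h : ℝ => (h : ℂ)⁻¹ • (heatPlus h x - heatPlus 0 x)) (𝓝[>] 0) (𝓝 z)) :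
    x ∈ heatDomain := by
  have h1 : ∀ k, coeff k z = -lam k * coeff k x := fun k =>
    tendsto_nhds_unique (((coeffL k).continuous.tendsto z).comp hz)
      (tendsto_coeff_heatPlus_quotient x k)
  rw [mem_heatDomain_iff]
  refine (hasSum_norm_coeff_sq z).summable.congr fun k => ?_
  rw [h1, norm_mul, norm_neg, Complex.norm_real, mul_pow, Real.norm_eq_abs, sq_abs]

lemma phi_mem_heatDomain (k : ℕ) : phi k ∈ heatDomain := by
  rw [mem_heatDomain_iff]
  refine summable_of_ne_finset_zero (s := {k}) fun j hj => ?_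
  rw [coeff_phi, if_neg (by simpa using hj)]
  simp

lemma dense_heatDomain : Dense (heatDomain : Set L2) := by
  have h := phiBasis.dense_span
  rw [Submodule.dense_iff_topologicalClosure_eq_top, eq_top_iff, ← h]
  refine Submodule.topologicalClosure_mono (Submodule.span_le.2 ?_)
  rintro _ ⟨k, rfl⟩
  rw [phiBasis_apply]
  exact phi_mem_heatDomain k

end HeatODE

/-! ### Submultiplicative functions and growth bounds -/

/-- A locally bounded submultiplicative function on `[0, ∞)` grows at most exponentially, at a rate
that can be read off at any positive time `τ`. -/
lemma exists_le_mul_exp_of_submultiplicative {g : ℝ → ℝ} (hg0 : ∀ t, 0 ≤ t → 0 ≤ g t)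
    (hmul : ∀ s t, 0 ≤ s → 0 ≤ t → g (s + t) ≤ g s * g t) {τ K r : ℝ} (hτ : 0 < τ)
    (hK : ∀ t, 0 ≤ t → t ≤ τ → g t ≤ K) (hr0 : 0 < r) (hr : g τ ≤ r) :
    ∃ C : ℝ, 0 < C ∧ ∀ t, 0 ≤ t → g t ≤ C * Real.exp (Real.log r / τ * t) := by
  have hstep : ∀ (j : ℕ) (s : ℝ), 0 ≤ s → s ≤ τ → g (j * τ + s) ≤ r ^ j * K := by
    intro j
    induction j with
    | zero => intro s hs hsτ; simpa using hK s hs hsτ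
    | succ j ih =>
      intro s hs hsτ
      have h1 : ((j + 1 : ℕ) : ℝ) * τ + s = τ + (j * τ + s) := by push_cast; ring
      have h2 : 0 ≤ j * τ + s := by positivity
      rw [h1, pow_succ']
      calc g (τ + (j * τ + s)) ≤ g τ * g (j * τ + s) := hmul _ _ hτ.le h2
        _ ≤ r * (r ^ j * K) := mul_le_mul hr (ih s hs hsτ) (hg0 _ h2) hr0.le
        _ = r * r ^ j * K := by ring
  have hK0 : 0 ≤ K := (hg0 0 le_rfl).trans (hK 0 le_rfl hτ.le)
  -- Replacing t/τ by its integer part changes the exponent by at most |log r|; K + 1 keeps the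
  -- constant positive.
  refine ⟨(K + 1) * Real.exp |Real.log r|, by positivity, fun t ht => ?_⟩
  set j := ⌊t / τ⌋₊ with hj
  have hj1 : (j : ℝ) ≤ t / τ := Nat.floor_le (by positivity)
  have hj2 : t / τ < j + 1 := Nat.lt_floor_add_one _
  rw [le_div_iff₀ hτ] at hj1
  rw [div_lt_iff₀ hτ] at hj2
  have h1 := hstep j (t - j * τ) (by linarith) (by linarith)
  rw [add_sub_cancel] at h1
  refine h1.trans ?_
  have h2 : r ^ j = Real.exp (j * Real.log r) := by
    rw [mul_comm, Real.exp_mul, Real.exp_log hr0, Real.rpow_natCast]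
  have h3 : (j : ℝ) * Real.log r ≤ |Real.log r| + Real.log r / τ * t := by
    have h4 : |(j - t / τ) * Real.log r| ≤ 1 * |Real.log r| := by
      rw [abs_mul]
      refine mul_le_mul_of_nonneg_right ?_ (abs_nonneg _)
      rw [abs_le]
      constructor
      · have := (div_lt_iff₀ hτ).2 hj2
        linarith
      · have := (le_div_iff₀ hτ).2 hj1
        linarith
    have h5 := (le_abs_self _).trans h4
    have h6 : Real.log r / τ * t = t / τ * Real.log r := by ring
    rw [h6]
    linarith
  calc r ^ j * K ≤ Real.exp (|Real.log r| + Real.log r / τ * t) * (K + 1) := by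
        rw [h2]
        exact mul_le_mul (Real.exp_le_exp.2 h3) (by linarith) hK0 (Real.exp_nonneg _)
    _ = (K + 1) * Real.exp |Real.log r| * Real.exp (Real.log r / τ * t) := by
        rw [Real.exp_add]; ring

namespace C0Semigroup

variable {X : Type*} [NormedAddCommGroup X] [NormedSpace ℂ X]

/-- A semigroup with an exponentially decaying upper bound and some exponential lower bound for its
norm is exponentially stable; in particular its growth bound exists as a limit. -/
lemma isExponentiallyStable_of_norm_le (T : C0Semigroup X) {C ε c : ℝ} (hε : 0 < ε)
    (hle : ∀ t : ℝ≥0, ‖T.op t‖ ≤ C * Real.exp (-ε * t))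
    (hge : ∀ t : ℝ≥0, Real.exp (-c * t) ≤ ‖T.op t‖) : T.IsExponentiallyStable := by
  have hpos : ∀ t, 0 < ‖T.op t‖ := fun t => (Real.exp_pos _).trans_le (hge t)
  set L : ℝ≥0 → ℝ := fun t => Real.log ‖T.op t‖ / t with hL
  have hC : 0 < C := by
    have := (hpos 0).trans_le (hle 0)
    exact (pos_iff_pos_of_mul_pos this).2 (Real.exp_pos _)
  have hlow : ∀ t : ℝ≥0, 0 < t → -c ≤ L t := by
    intro t ht
    rw [hL, le_div_iff₀ (by exact_mod_cast ht), Real.le_log_iff_exp_le (hpos t)]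
    exact hge t
  have hbdd : BddBelow (L '' Set.Ioi 0) := ⟨-c, by rintro _ ⟨t, ht, rfl⟩; exact hlow t ht⟩
  -- Fekete's lemma: the limit of log‖T(t)‖/t is its infimum over t > 0.
  set ω := sInf (L '' Set.Ioi 0) with hω
  have hωle : ∀ t : ℝ≥0, 0 < t → ω ≤ L t := fun t ht => csInf_le hbdd ⟨t, ht, rfl⟩
  have hrate : ∀ {C' a : ℝ}, 0 < C' → (∀ t : ℝ≥0, ‖T.op t‖ ≤ C' * Real.exp (a * t)) →
      ∀ b, a < b → ∀ᶠ t : ℝ≥0 in atTop, L t < b := by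
    intro C' a hC' h b hab
    have h1 : Tendsto (fun t : ℝ≥0 => Real.log C' / (t : ℝ) + a) atTop (𝓝 (0 + a)) :=
      (Tendsto.div_atTop tendsto_const_nhds (NNReal.tendsto_coe_atTop.2 tendsto_id)).add_const a
    rw [zero_add] at h1
    filter_upwards [h1.eventually_lt_const hab, eventually_gt_atTop 0] with t ht ht0
    refine lt_of_le_of_lt ?_ ht
    have ht0' : (0 : ℝ) < t := by exact_mod_cast ht0
    rw [hL]
    change Real.log ‖T.op t‖ / t ≤ _
    rw [div_add' _ _ _ ht0'.ne', div_le_div_iff_of_pos_right ht0',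
      ← Real.log_exp (a * t), ← Real.log_mul hC'.ne' (Real.exp_pos _).ne']
    exact Real.log_le_log (hpos t) (h t)
  have htend : Tendsto L atTop (𝓝 ω) := by
    rw [tendsto_order]
    constructor
    · intro a ha
      filter_upwards [eventually_gt_atTop 0] with t ht
      exact ha.trans_le (hωle t ht)
    · intro b hb
      -- One time τ with rate below b suffices: by submultiplicativity its rate bounds the growth at
      -- all times, up to a constant factor.
      obtain ⟨_, ⟨τ, hτ, rfl⟩, hτb⟩ := (csInf_lt_iff hbdd ⟨_, 1, Set.mem_Ioi.2 one_pos, rfl⟩).1 hb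
      obtain ⟨C', hC', h⟩ := exists_le_mul_exp_of_submultiplicative
        (g := fun t => ‖T.op t.toNNReal‖) (τ := τ) (K := C) (r := ‖T.op τ‖)
        (fun t _ => norm_nonneg _)
        (fun s t hs ht => by
          rw [Real.toNNReal_add hs ht, T.op_add]
          exact ContinuousLinearMap.opNorm_comp_le _ _)
        (by exact_mod_cast hτ)
        (fun t ht _ => (hle _).trans
          (mul_le_of_le_one_right hC.le (Real.exp_le_one_iff.2 (by
            have := NNReal.coe_nonneg t.toNNReal
            nlinarith))))
        (hpos τ) (by rw [Real.toNNReal_coe])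
      refine hrate hC' (a := L τ) (fun t => ?_) b hτb
      have := h t t.2
      rwa [Real.toNNReal_coe] at this
  refine ⟨(ω : EReal), ?_, ?_⟩
  · refine (EReal.tendsto_coe.2 htend).congr' ?_
    filter_upwards [eventually_gt_atTop 0] with t _
    rw [hL, EReal.coe_div, ← ofReal_norm, ENNReal.log_ofReal_of_pos (hpos t)]
  · have h1 : ω ≤ -ε / 2 := by
      refine le_of_tendsto htend ?_
      filter_upwards [hrate hC hle (-ε / 2) (by linarith)] with t ht using ht.le
    have h2 : ω < 0 := by linarith
    exact_mod_cast h2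

end C0Semigroup

/-! ### Exponentials of operators on finite-dimensional spaces -/

section Exp

variable {W : Type*} [NormedAddCommGroup W] [NormedSpace ℂ W]

/-- The one-parameter group generated by a bounded operator. -/
def expOp (M : W →L[ℂ] W) (t : ℝ) : W →L[ℂ] W := NormedSpace.exp ((t : ℂ) • M)

lemma expOp_zero (M : W →L[ℂ] W) : expOp M 0 = 1 := by simp [expOp]

variable [CompleteSpace W]

lemma expOp_add (M : W →L[ℂ] W) (s t : ℝ) : expOp M (s + t) = expOp M s * expOp M t := by
  rw [expOp, Complex.ofReal_add, add_smul]
  let _ : NormedAlgebra ℚ (W →L[ℂ] W) := NormedAlgebra.restrictScalars ℚ ℂ _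
  exact NormedSpace.exp_add_of_commute (((Commute.refl M).smul_left _).smul_right _)

lemma hasDerivAt_expOp (M : W →L[ℂ] W) (t : ℝ) :
    HasDerivAt (expOp M) (expOp M t * M) t := by
  have h := HasDerivAt.scomp t (hasDerivAt_exp_smul_const (𝕂 := ℂ) M (t : ℂ))
    Complex.ofRealCLM.hasDerivAt
  rw [Complex.ofRealCLM_apply, Complex.ofReal_one, one_smul] at h
  exact h

lemma continuous_expOp (M : W →L[ℂ] W) : Continuous (expOp M) :=
  continuous_iff_continuousAt.2 fun t => (hasDerivAt_expOp M t).continuousAt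

lemma expOp_natCast (M : W →L[ℂ] W) (k : ℕ) : expOp M k = (expOp M 1) ^ k := by
  induction k with
  | zero => simp [expOp_zero]
  | succ k ih => rw [Nat.cast_succ, expOp_add, ih, pow_succ]

lemma exp_apply_of_eigenvector {M : W →L[ℂ] W} {z : ℂ} {v : W} (h : M v = z • v) :
    NormedSpace.exp M v = Complex.exp z • v := by
  have h1 := (ContinuousLinearMap.apply ℂ W v).hasSum
    (NormedSpace.exp_series_hasSum_exp' (𝕂 := ℂ) M)
  have hpow : ∀ k : ℕ, (M ^ k) v = z ^ k • v := by
    intro k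
    induction k with
    | zero => simp
    | succ k ih =>
      rw [pow_succ, mul_apply_eq_comp, h, map_smul, ih, smul_smul, pow_succ, mul_comm]
  have h2 := (NormedSpace.exp_series_hasSum_exp' (𝕂 := ℂ) z).smul_const v
  rw [← Complex.exp_eq_exp_ℂ] at h2
  refine h1.unique ?_
  convert h2 using 2 with k
  simp [hpow, smul_smul]

/-- `M` commutes with its exponential, so it preserves the eigenspace of the exponential at μ and
has an eigenvector there; the exponential acts on that vector both as e^z and as μ. -/
lemma exists_eigenvector_of_mem_spectrum_exp [FiniteDimensional ℂ W] {M : W →L[ℂ] W} {μ : ℂ}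
    (hμ : μ ∈ spectrum ℂ (NormedSpace.exp M)) :
    ∃ (z : ℂ) (v : W), v ≠ 0 ∧ M v = z • v ∧ μ = Complex.exp z := by
  set a := NormedSpace.exp M with ha
  have hcomm : Commute M a := (Commute.refl M).exp_right
  let al : Module.End ℂ W := a.toLinearMap
  have hμ' : μ ∈ spectrum ℂ al := by
    intro hu
    apply hμ
    have h := hu.map (Module.End.toContinuousLinearMap W)
    have e : algebraMap ℂ (W →L[ℂ] W) μ - a
        = Module.End.toContinuousLinearMap W (algebraMap ℂ (Module.End ℂ W) μ - al) := by
      ext v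
      simp [al, Algebra.algebraMap_eq_smul_one]
      rfl
    rw [← e] at h
    exact h
  have hev := Module.End.hasEigenvalue_iff_mem_spectrum.2 hμ'
  have hmaps : ∀ v ∈ Module.End.eigenspace al μ, M.toLinearMap v ∈ Module.End.eigenspace al μ := by
    intro v hv
    rw [Module.End.mem_eigenspace_iff] at hv ⊢
    change a v = μ • v at hv
    change a (M v) = μ • M v
    rw [← mul_apply_eq_comp, ← hcomm.eq, mul_apply_eq_comp, hv, map_smul]
  have : Nontrivial (Module.End.eigenspace al μ) :=
    Submodule.nontrivial_iff_ne_bot.2 hev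
  obtain ⟨z, hz⟩ := Module.End.exists_eigenvalue (M.toLinearMap.restrict hmaps)
  obtain ⟨v, hv⟩ := hz.exists_hasEigenvector
  have hv0 : (v : W) ≠ 0 := by simpa using hv.2
  have hMv : M (v : W) = z • (v : W) := by
    have := congrArg Subtype.val hv.apply_eq_smul
    exact this
  refine ⟨z, v, hv0, hMv, ?_⟩
  have h1 : a (v : W) = μ • (v : W) := Module.End.mem_eigenspace_iff.1 v.2
  rw [ha, exp_apply_of_eigenvector hMv] at h1
  exact (smul_left_injective ℂ hv0 h1).symm

/-- If all eigenvalues of an operator on a finite-dimensional space have negative real part, then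
its exponential decays. -/
lemma exists_norm_expOp_le [FiniteDimensional ℂ W] [Nontrivial W] (M : W →L[ℂ] W)
    (hM : ∀ (z : ℂ) (v : W), v ≠ 0 → M v = z • v → z.re < 0) :
    ∃ C ε : ℝ, 0 < C ∧ 0 < ε ∧ ∀ t : ℝ, 0 ≤ t → ‖expOp M t‖ ≤ C * Real.exp (-ε * t) := by
  set a : W →L[ℂ] W := NormedSpace.exp M with ha
  have ha1 : expOp M 1 = a := by simp [expOp, ha]
  -- The spectrum of e^M consists of numbers e^z with Re z < 0. By Gelfand's formula some power of
  -- e^M then has norm below 1.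
  have hrad : spectralRadius ℂ a < (1 : ℝ≥0) := by
    refine spectrum.spectralRadius_lt_of_forall_lt a fun μ hμ => ?_
    obtain ⟨z, v, hv, hMv, rfl⟩ := exists_eigenvector_of_mem_spectrum_exp hμ
    rw [← NNReal.coe_lt_coe, coe_nnnorm, Complex.norm_exp]
    simpa using hM z v hv hMv
  have hlim := spectrum.pow_nnnorm_pow_one_div_tendsto_nhds_spectralRadius a
  obtain ⟨k, hk, hk0⟩ := ((hlim.eventually_lt_const hrad).and (eventually_gt_atTop 0)).exists
  have hk1 : ‖a ^ k‖ < 1 := by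
    by_contra hcon
    push Not at hcon
    refine absurd hk (not_lt.2 ?_)
    have : (1 : ℝ≥0∞) ≤ ‖a ^ k‖₊ := by
      exact_mod_cast hcon
    simpa using ENNReal.one_le_rpow this (by positivity)
  obtain ⟨K, hK⟩ := (isCompact_Icc (a := (0 : ℝ)) (b := k)).exists_bound_of_continuousOn
    (continuous_expOp M).continuousOn
  have hk0' : (0 : ℝ) < k := by exact_mod_cast hk0
  -- The maximum with 1/2 guarantees a positive argument for the logarithm and stays below 1.
  obtain ⟨C, hC, h⟩ := exists_le_mul_exp_of_submultiplicative (g := fun t => ‖expOp M t‖)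
    (τ := k) (K := K) (r := max ‖a ^ k‖ 2⁻¹) (fun _ _ => norm_nonneg _)
    (fun s t _ _ => by rw [expOp_add]; exact norm_mul_le _ _) hk0'
    (fun t h0 h1 => hK t ⟨h0, h1⟩) (lt_max_of_lt_right (by norm_num))
    (by rw [expOp_natCast, ha1]; exact le_max_left _ _)
  refine ⟨C, -(Real.log (max ‖a ^ k‖ 2⁻¹) / k), hC, ?_, fun t ht => ?_⟩
  · have := Real.log_neg (lt_max_of_lt_right (by norm_num : (0 : ℝ) < 2⁻¹))
      (max_lt hk1 (by norm_num))
    have := div_neg_of_neg_of_pos this hk0'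
    linarith
  · rw [neg_neg]
    exact h t ht

end Exp

namespace HeatODE

/-! ### The response of the heat equation to a finite-dimensional system -/

/-- The finite-dimensional part of the state: the mean value of the temperature and the state of
the ordinary differential equation. -/
abbrev SlowState (n : ℕ) : Type := ℂ × EuclideanSpace ℂ (Fin n)

section Forced

variable {n : ℕ} (M : SlowState n →L[ℂ] SlowState n) (R : SlowState n →L[ℂ] L2)

/-- The integrand of the variation of constants formula. -/
def forcing (t s : ℝ) (w : SlowState n) : L2 := heatPlus (t - s) (R (expOp M s w))

lemma continuous_expOp_apply (w : SlowState n) : Continuous fun s => expOp M s w :=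
  (continuous_expOp M).clm_apply continuous_const

lemma continuous_forcing (w : SlowState n) :
    Continuous fun p : ℝ × ℝ => forcing M R p.1 p.2 w := by
  refine continuous_heatPlus_uncurry.comp (f := fun p : ℝ × ℝ => (p.1 - p.2, R (expOp M p.2 w))) ?_
  have := continuous_expOp_apply M w
  fun_prop

lemma continuous_forcing_right (t : ℝ) (w : SlowState n) :
    Continuous fun s => forcing M R t s w :=
  (continuous_forcing M R w).comp (f := fun s : ℝ => (t, s)) (by fun_prop)

lemma intervalIntegrable_forcing (t : ℝ) (w : SlowState n) (a b : ℝ) :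
    IntervalIntegrable (fun s => forcing M R t s w) volume a b :=
  (continuous_forcing_right M R t w).intervalIntegrable a b

/-- The part of the temperature, without its mean value, that is produced up to time `t` by the
input `R` driven by the system `M`. -/
def forcedResponse (t : ℝ) : SlowState n →L[ℂ] L2 :=
  LinearMap.toContinuousLinearMap
    { toFun := fun w => ∫ s in (0 : ℝ)..t, forcing M R t s w
      map_add' := by
        intro v w
        rw [← intervalIntegral.integral_add (intervalIntegrable_forcing M R t v 0 t)
          (intervalIntegrable_forcing M R t w 0 t)]
        simp [forcing]
      map_smul' := by
        intro c w
        rw [RingHom.id_apply, ← intervalIntegral.integral_smul]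
        simp [forcing] }

lemma forcedResponse_apply (t : ℝ) (w : SlowState n) :
    forcedResponse M R t w = ∫ s in (0 : ℝ)..t, forcing M R t s w := rfl

lemma continuous_forcedResponse (w : SlowState n) :
    Continuous fun t => forcedResponse M R t w :=
  intervalIntegral.continuous_parametric_intervalIntegral_of_continuous
    (f := fun t s => forcing M R t s w) (continuous_forcing M R w) continuous_id

@[simp] lemma forcedResponse_zero (w : SlowState n) : forcedResponse M R 0 w = 0 := by
  simp [forcedResponse_apply]

@[simp] lemma coeff_zero_forcedResponse (t : ℝ) (w : SlowState n) :
    coeff 0 (forcedResponse M R t w) = 0 := by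
  rw [forcedResponse_apply, ← coeffL_apply,
    ← (coeffL 0).intervalIntegral_comp_comm (intervalIntegrable_forcing M R t w 0 t)]
  simp [forcing, -coeff_heatPlus]

/-- Split the integral at t: on [0, t] the heat flow over time s factors out, and on [t, s + t] a
shift restarts the forcing from the slow state reached at time t. This cocycle identity is the core
of the semigroup law. -/
lemma forcedResponse_add {s t : ℝ} (hs : 0 ≤ s) (ht : 0 ≤ t) (w : SlowState n) :
    forcedResponse M R (s + t) w
      = heatPlus s (forcedResponse M R t w) + forcedResponse M R s (expOp M t w) := by
  simp only [forcedResponse_apply]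
  rw [← intervalIntegral.integral_add_adjacent_intervals
    (intervalIntegrable_forcing M R (s + t) w 0 t)
    (intervalIntegrable_forcing M R (s + t) w t (s + t)),
    ← (heatPlus s).intervalIntegral_comp_comm (intervalIntegrable_forcing M R t w 0 t)]
  congr 1
  · refine intervalIntegral.integral_congr fun r hr => ?_
    rw [Set.uIcc_of_le ht] at hr
    simp only [forcing]
    rw [heatPlus_add hs (sub_nonneg.2 hr.2), add_sub_assoc]
  · have h := intervalIntegral.integral_comp_add_right (a := 0) (b := s)
      (fun r => forcing M R (s + t) r w) t
    rw [zero_add] at h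
    rw [← h]
    refine intervalIntegral.integral_congr fun r _ => ?_
    simp only [forcing]
    rw [expOp_add, mul_apply_eq_comp, add_sub_add_right_eq_sub]

/-- The quotient is an average over [0, h] of an integrand that itself depends on h, so joint
continuity at (0, 0) is what is used. -/
lemma tendsto_forcedResponse_quotient (w : SlowState n) :
    Tendsto (fun h : ℝ => (h : ℂ)⁻¹ • forcedResponse M R h w) (𝓝[>] 0)
      (𝓝 (heatPlus 0 (R w))) := by
  have h0 : forcing M R 0 0 w = heatPlus 0 (R w) := by simp [forcing, expOp_zero]
  rw [Metric.tendsto_nhdsWithin_nhds]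
  intro ε hε
  obtain ⟨δ, hδ, h⟩ := Metric.continuousAt_iff.1
    ((continuous_forcing M R w).continuousAt (x := ((0 : ℝ), (0 : ℝ)))) (ε / 2) (by positivity)
  refine ⟨δ, hδ, fun {x} (hx : 0 < x) hxδ => ?_⟩
  rw [Real.dist_eq, sub_zero, abs_of_pos hx] at hxδ
  have h1 : ∀ s ∈ Set.uIoc 0 x, ‖forcing M R x s w - heatPlus 0 (R w)‖ ≤ ε / 2 := by
    intro s hs
    rw [Set.uIoc_of_le hx.le] at hs
    have := h (x := (x, s)) (by
      rw [Prod.dist_eq, max_lt_iff, Real.dist_eq, Real.dist_eq, sub_zero, sub_zero,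
        abs_of_pos hx, abs_of_pos hs.1]
      exact ⟨hxδ, hs.2.trans_lt hxδ⟩)
    rw [dist_eq_norm] at this
    rw [← h0]
    exact this.le
  have h2 := intervalIntegral.norm_integral_le_of_norm_le_const h1
  rw [intervalIntegral.integral_sub (intervalIntegrable_forcing M R x w 0 x)
    intervalIntegrable_const, ← forcedResponse_apply, intervalIntegral.integral_const, sub_zero,
    abs_of_pos hx] at h2
  have hx0 : (x : ℂ) ≠ 0 := by exact_mod_cast hx.ne'
  have h3 : (x : ℂ)⁻¹ • forcedResponse M R x w - heatPlus 0 (R w)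
      = (x : ℂ)⁻¹ • (forcedResponse M R x w - x • heatPlus 0 (R w)) := by
    have h4 : x • heatPlus 0 (R w) = (x : ℂ) • heatPlus 0 (R w) :=
      RCLike.real_smul_eq_coe_smul (K := ℂ) x _
    rw [h4, smul_sub, smul_smul, inv_mul_cancel₀ hx0, one_smul]
  rw [dist_eq_norm, h3, norm_smul, norm_inv, Complex.norm_real, Real.norm_of_nonneg hx.le,
    inv_mul_lt_iff₀ hx]
  nlinarith

lemma norm_forcedResponse_le {C δ : ℝ} (hC : 0 ≤ C) (hδ : 0 < δ) (hδπ : δ ≤ Real.pi ^ 2)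
    (hM : ∀ t, 0 ≤ t → ‖expOp M t‖ ≤ C * Real.exp (-δ * t)) {t : ℝ} (ht : 0 ≤ t)
    (w : SlowState n) :
    ‖forcedResponse M R t w‖ ≤ (2 / δ * ‖R‖ * C) * Real.exp (-(δ / 2) * t) * ‖w‖ := by
  have h1 : ∀ s ∈ Set.uIoc 0 t,
      ‖forcing M R t s w‖ ≤ ‖R‖ * C * Real.exp (-δ * t) * ‖w‖ := by
    intro s hs
    rw [Set.uIoc_of_le ht] at hs
    have hts : 0 ≤ t - s := sub_nonneg.2 hs.2
    calc ‖forcing M R t s w‖ ≤ Real.exp (-Real.pi ^ 2 * (t - s)) * ‖R (expOp M s w)‖ :=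
          norm_heatPlus_apply_le hts _
      _ ≤ Real.exp (-δ * (t - s)) * (‖R‖ * (C * Real.exp (-δ * s) * ‖w‖)) := by
          refine mul_le_mul (Real.exp_le_exp.2 (by nlinarith)) ?_ (norm_nonneg _)
            (Real.exp_nonneg _)
          refine (R.le_opNorm _).trans (mul_le_mul_of_nonneg_left ?_ (norm_nonneg _))
          exact ((expOp M s).le_opNorm _).trans
            (mul_le_mul_of_nonneg_right (hM s hs.1.le) (norm_nonneg _))
      _ = ‖R‖ * C * (Real.exp (-δ * (t - s)) * Real.exp (-δ * s)) * ‖w‖ := by ring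
      _ = ‖R‖ * C * Real.exp (-δ * t) * ‖w‖ := by
          rw [← Real.exp_add]
          ring_nf
  have h2 := intervalIntegral.norm_integral_le_of_norm_le_const h1
  rw [sub_zero, abs_of_nonneg ht, ← forcedResponse_apply] at h2
  refine h2.trans ?_
  -- Heat flow and forcing decay at the common rate δ, so integration yields t e^{-δt}; half of the
  -- rate is spent on absorbing the factor t.
  have h3 : t ≤ 2 / δ * Real.exp (δ / 2 * t) := by
    have := Real.add_one_le_exp (δ / 2 * t)
    have h4 : t = 2 / δ * (δ / 2 * t) := by field_simp
    rw [h4]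
    refine mul_le_mul_of_nonneg_left ?_ (by positivity)
    rw [← h4]
    linarith
  calc ‖R‖ * C * Real.exp (-δ * t) * ‖w‖ * t
      ≤ ‖R‖ * C * Real.exp (-δ * t) * ‖w‖ * (2 / δ * Real.exp (δ / 2 * t)) := by gcongr
    _ = (2 / δ * ‖R‖ * C) * (Real.exp (-δ * t) * Real.exp (δ / 2 * t)) * ‖w‖ := by ring
    _ = (2 / δ * ‖R‖ * C) * Real.exp (-(δ / 2) * t) * ‖w‖ := by
        rw [← Real.exp_add]
        ring_nf

end Forced

/-! ### The semigroup of the cascade -/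

section State

variable {n : ℕ}

lemma state_ext {x y : State n} (h1 : x.fst = y.fst) (h2 : x.snd = y.snd) : x = y :=
  (WithLp.equiv 2 _).injective (Prod.ext h1 h2)

lemma tendsto_state_iff {α : Type*} {l : Filter α} {u : α → State n} {y : State n} :
    Tendsto u l (𝓝 y) ↔ Tendsto (fun a => (u a).fst) l (𝓝 y.fst) ∧
      Tendsto (fun a => (u a).snd) l (𝓝 y.snd) := by
  constructor
  · intro h
    exact ⟨((WithLp.fstL 2 ℂ L2 (EuclideanSpace ℂ (Fin n))).continuous.tendsto y).comp h,
      ((WithLp.sndL 2 ℂ L2 (EuclideanSpace ℂ (Fin n))).continuous.tendsto y).comp h⟩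
  · rintro ⟨h1, h2⟩
    exact ((WithLp.prodContinuousLinearEquiv 2 ℂ L2
      (EuclideanSpace ℂ (Fin n))).symm.continuous.tendsto (y.fst, y.snd)).comp (h1.prodMk_nhds h2)

lemma norm_state_le (x : State n) : ‖x‖ ≤ ‖x.fst‖ + ‖x.snd‖ := by
  rw [WithLp.prod_norm_eq_of_L2]
  refine Real.sqrt_le_iff.2 ⟨by positivity, ?_⟩
  nlinarith [norm_nonneg x.fst, norm_nonneg x.snd]

/-- The projection of the state to its finite-dimensional part. -/
def slowPart (n : ℕ) : State n →L[ℂ] SlowState n :=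
  ((coeffL 0) ∘L WithLp.fstL 2 ℂ L2 (EuclideanSpace ℂ (Fin n))).prod
    (WithLp.sndL 2 ℂ L2 (EuclideanSpace ℂ (Fin n)))

@[simp] lemma slowPart_apply (x : State n) : slowPart n x = (coeff 0 x.fst, x.snd) := rfl

variable (M : SlowState n →L[ℂ] SlowState n) (R : SlowState n →L[ℂ] L2)

/-- The operators of the semigroup on `L²(0,1) × ℂⁿ` for which the finite-dimensional part follows
the system `M` and drives the heat equation through `R`. -/
def cascadeOp (t : ℝ) : State n →L[ℂ] State n :=
  (WithLp.prodContinuousLinearEquiv 2 ℂ L2 (EuclideanSpace ℂ (Fin n))).symm.toContinuousLinearMap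
    ∘L (((ContinuousLinearMap.fst ℂ ℂ (EuclideanSpace ℂ (Fin n))).smulRight (phi 0) ∘L
            expOp M t ∘L slowPart n
          + heatPlus t ∘L WithLp.fstL 2 ℂ L2 (EuclideanSpace ℂ (Fin n))
          + forcedResponse M R t ∘L slowPart n).prod
        (ContinuousLinearMap.snd ℂ ℂ (EuclideanSpace ℂ (Fin n)) ∘L expOp M t ∘L slowPart n))

lemma cascadeOp_fst (t : ℝ) (x : State n) :
    (cascadeOp M R t x).fst = (expOp M t (slowPart n x)).1 • phi 0 + heatPlus t x.fst
      + forcedResponse M R t (slowPart n x) := rfl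

lemma cascadeOp_snd (t : ℝ) (x : State n) :
    (cascadeOp M R t x).snd = (expOp M t (slowPart n x)).2 := rfl

/-- The free heat part and the forced response have zero mean, so neither feeds back into the slow
state. -/
lemma slowPart_cascadeOp (t : ℝ) (x : State n) :
    slowPart n (cascadeOp M R t x) = expOp M t (slowPart n x) := by
  rw [slowPart_apply (cascadeOp M R t x), cascadeOp_fst, cascadeOp_snd]
  ext1
  · simp [coeff_phi, -slowPart_apply, -coeff_heatPlus]
  · rfl

lemma cascadeOp_zero : cascadeOp M R 0 = ContinuousLinearMap.id ℂ (State n) := by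
  ext1 x
  refine state_ext ?_ ?_
  · rw [cascadeOp_fst, expOp_zero, forcedResponse_zero, heatPlus_zero]
    simp
  · rw [cascadeOp_snd, expOp_zero]
    simp

lemma cascadeOp_add {s t : ℝ} (hs : 0 ≤ s) (ht : 0 ≤ t) :
    cascadeOp M R (s + t) = (cascadeOp M R s).comp (cascadeOp M R t) := by
  ext1 x
  rw [ContinuousLinearMap.comp_apply]
  refine state_ext ?_ ?_
  · rw [cascadeOp_fst M R s, slowPart_cascadeOp, cascadeOp_fst, cascadeOp_fst, map_add, map_add,
      map_smul, heatPlus_phi_zero, smul_zero, zero_add, heatPlus_add hs ht,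
      forcedResponse_add M R hs ht, expOp_add, mul_apply_eq_comp]
    abel
  · rw [cascadeOp_snd M R s, slowPart_cascadeOp, cascadeOp_snd, expOp_add, mul_apply_eq_comp]

lemma continuous_cascadeOp_apply (x : State n) : Continuous fun t => cascadeOp M R t x := by
  have h1 := continuous_expOp_apply M (slowPart n x)
  have h2 := continuous_heatPlus_apply x.fst
  have h3 := continuous_forcedResponse M R (slowPart n x)
  refine continuous_iff_continuousAt.2 fun t => tendsto_state_iff.2 ⟨?_, ?_⟩
  · simp only [cascadeOp_fst]
    exact (((h1.fst.smul continuous_const).add h2).add h3).tendsto t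
  · simp only [cascadeOp_snd]
    exact h1.snd.tendsto t

/-- The semigroup of the cascade. -/
def cascadeSemigroup : C0Semigroup (State n) where
  op t := cascadeOp M R t
  op_zero := cascadeOp_zero M R
  op_add s t := cascadeOp_add M R s.2 t.2
  tendsto_zero x := by
    have h := ((continuous_cascadeOp_apply M R x).comp NNReal.continuous_coe).tendsto 0
    simpa [Function.comp_def, cascadeOp_zero] using h

lemma tendsto_expOp_quotient (w : SlowState n) :
    Tendsto (fun h : ℝ => (h : ℂ)⁻¹ • (expOp M h w - w)) (𝓝[>] 0) (𝓝 (M w)) := by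
  have h1 : HasDerivAt (fun h : ℝ => expOp M h w) (M w) 0 := by
    have h := ((ContinuousLinearMap.apply ℂ (SlowState n) w).restrictScalars
      ℝ).hasFDerivAt.comp_hasDerivAt (0 : ℝ) (hasDerivAt_expOp M 0)
    rw [expOp_zero, one_mul] at h
    exact h
  have h2 := h1.tendsto_slope.mono_left (nhdsWithin_mono (0 : ℝ)
    (fun x (hx : 0 < x) => (ne_of_gt hx : x ≠ 0)))
  refine h2.congr fun h => ?_
  rw [slope_def_module, sub_zero, expOp_zero, ← Complex.coe_smul, Complex.ofReal_inv]
  rfl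

lemma cascade_quotient_fst (h : ℝ) (x : State n) :
    ((h : ℂ)⁻¹ • (cascadeOp M R h x - x)).fst
      = ((h : ℂ)⁻¹ • (expOp M h (slowPart n x) - slowPart n x)).1 • phi 0
        + (h : ℂ)⁻¹ • forcedResponse M R h (slowPart n x)
        + (h : ℂ)⁻¹ • (heatPlus h x.fst - heatPlus 0 x.fst) := by
  rw [WithLp.smul_fst, WithLp.sub_fst, cascadeOp_fst, heatPlus_zero, Prod.smul_fst, Prod.fst_sub]
  simp only [slowPart_apply, smul_sub, smul_add, sub_smul, smul_eq_mul, mul_sub, mul_smul]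
  abel

/-- The difference quotients of the cascade converge exactly if the temperature lies in the domain
of the Neumann Laplacian; the limit is given by the cascade of the two equations. -/
lemma tendsto_cascade_quotient_iff (x y : State n) :
    Tendsto (fun h : ℝ => (h : ℂ)⁻¹ • (cascadeOp M R h x - x)) (𝓝[>] 0) (𝓝 y) ↔
      ∃ hx : x.fst ∈ heatOp.domain,
        y.fst = (M (slowPart n x)).1 • phi 0 + heatPlus 0 (R (slowPart n x)) + heatOp ⟨x.fst, hx⟩ ∧
        y.snd = (M (slowPart n x)).2 := by
  have h1 := tendsto_expOp_quotient M (slowPart n x)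
  have h2 := tendsto_forcedResponse_quotient M R (slowPart n x)
  have h12 := (((continuous_fst.tendsto _).comp h1).smul_const (phi 0)).add h2
  have hsnd := (continuous_snd.tendsto _).comp h1
  rw [tendsto_state_iff]
  constructor
  · rintro ⟨ha, hb⟩
    -- The slow and forced quotients converge for every x; subtracting them isolates the heat
    -- quotient, whose convergence decides membership in the domain.
    have h3 : Tendsto (fun h : ℝ => (h : ℂ)⁻¹ • (heatPlus h x.fst - heatPlus 0 x.fst)) (𝓝[>] 0)
        (𝓝 (y.fst - ((M (slowPart n x)).1 • phi 0 + heatPlus 0 (R (slowPart n x))))) := by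
      refine (ha.sub h12).congr fun h => ?_
      rw [cascade_quotient_fst]
      exact add_sub_cancel_left _ _
    have hx := mem_heatDomain_of_tendsto h3
    refine ⟨hx, ?_, tendsto_nhds_unique hb hsnd⟩
    have h4 := tendsto_nhds_unique h3 (tendsto_heatPlus_quotient ⟨x.fst, hx⟩)
    rw [← h4]
    abel
  · rintro ⟨hx, ha, hb⟩
    rw [ha, hb]
    refine ⟨(h12.add (tendsto_heatPlus_quotient ⟨x.fst, hx⟩)).congr fun h => ?_, hsnd⟩
    rw [cascade_quotient_fst]
    rfl

lemma exists_norm_cascadeOp_le {C ε : ℝ} (hC : 0 < C) (hε : 0 < ε)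
    (hM : ∀ t, 0 ≤ t → ‖expOp M t‖ ≤ C * Real.exp (-ε * t)) :
    ∃ C' δ : ℝ, 0 < δ ∧ ∀ t, 0 ≤ t → ‖cascadeOp M R t‖ ≤ C' * Real.exp (-δ * t) := by
  set δ := min ε (Real.pi ^ 2) with hδ
  have hδ0 : 0 < δ := lt_min hε (by positivity)
  have hM' : ∀ t, 0 ≤ t → ‖expOp M t‖ ≤ C * Real.exp (-δ * t) := fun t ht =>
    (hM t ht).trans (mul_le_mul_of_nonneg_left (Real.exp_le_exp.2 (by
      nlinarith [min_le_left ε (Real.pi ^ 2)])) hC.le)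
  set q := ‖slowPart n‖ with hq
  -- The four summands bound the mean, the free heat flow, the forced response and the ODE
  -- component, in this order.
  refine ⟨C * q + 1 + (2 / δ * ‖R‖ * C) * q + C * q, δ / 2, by positivity, fun t ht => ?_⟩
  refine ContinuousLinearMap.opNorm_le_bound _ (by positivity) fun x => ?_
  set e := Real.exp (-(δ / 2) * t) with he
  have he0 : 0 ≤ e := Real.exp_nonneg _
  have hw : ‖slowPart n x‖ ≤ q * ‖x‖ := (slowPart n).le_opNorm x
  have hE : ‖expOp M t (slowPart n x)‖ ≤ C * q * e * ‖x‖ := by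
    calc ‖expOp M t (slowPart n x)‖ ≤ (C * Real.exp (-δ * t)) * (q * ‖x‖) :=
          ((expOp M t).le_opNorm _).trans
            (mul_le_mul (hM' t ht) hw (norm_nonneg _) (by positivity))
      _ ≤ (C * e) * (q * ‖x‖) := by
          refine mul_le_mul_of_nonneg_right (mul_le_mul_of_nonneg_left ?_ hC.le) (by positivity)
          exact Real.exp_le_exp.2 (by nlinarith)
      _ = C * q * e * ‖x‖ := by ring
  have hphi : ‖phi 0‖ = 1 := orthonormal_phi.1 0
  have h1 : ‖(expOp M t (slowPart n x)).1 • phi 0‖ ≤ C * q * e * ‖x‖ := by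
    rw [norm_smul, hphi, mul_one]
    exact (norm_fst_le _).trans hE
  have h2 : ‖heatPlus t x.fst‖ ≤ e * ‖x‖ := by
    refine (norm_heatPlus_apply_le ht _).trans (mul_le_mul ?_ (WithLp.norm_fst_le _ x)
      (norm_nonneg _) he0)
    exact Real.exp_le_exp.2 (by nlinarith [min_le_right ε (Real.pi ^ 2)])
  have h3 : ‖forcedResponse M R t (slowPart n x)‖ ≤ (2 / δ * ‖R‖ * C) * q * e * ‖x‖ := by
    refine (norm_forcedResponse_le M R hC.le hδ0 (min_le_right _ _) hM' ht _).trans ?_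
    calc _ ≤ (2 / δ * ‖R‖ * C) * e * (q * ‖x‖) := by gcongr
      _ = _ := by ring
  have h4 : ‖(expOp M t (slowPart n x)).2‖ ≤ C * q * e * ‖x‖ := (norm_snd_le _).trans hE
  refine (norm_state_le _).trans ?_
  rw [cascadeOp_fst, cascadeOp_snd]
  have h5 := norm_add₃_le (a := (expOp M t (slowPart n x)).1 • phi 0) (b := heatPlus t x.fst)
    (c := forcedResponse M R t (slowPart n x))
  calc _ ≤ C * q * e * ‖x‖ + e * ‖x‖ + (2 / δ * ‖R‖ * C) * q * e * ‖x‖ + C * q * e * ‖x‖ := by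
        linarith
    _ = _ := by ring

/-- The state (φ₁, 0) has zero slow part, so it evolves freely as e^{-π²t}φ₁. -/
lemma exp_le_norm_cascadeOp {t : ℝ} (ht : 0 ≤ t) :
    Real.exp (-Real.pi ^ 2 * t) ≤ ‖cascadeOp M R t‖ := by
  let x : State n := WithLp.toLp 2 (phi 1, 0)
  have hx1 : x.fst = phi 1 := rfl
  have hx2 : x.snd = 0 := rfl
  have hphi : ‖phi 1‖ = 1 := orthonormal_phi.1 1
  have hx : ‖x‖ = 1 := by
    rw [WithLp.prod_norm_eq_of_L2, hx1, hx2, hphi]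
    simp
  have hslow : slowPart n x = 0 := by
    rw [slowPart_apply, hx1, hx2, coeff_phi]
    simp
  have h1 : (cascadeOp M R t x).fst = (Real.exp (-Real.pi ^ 2 * t) : ℂ) • phi 1 := by
    rw [cascadeOp_fst, hslow, hx1]
    simp only [map_zero, Prod.fst_zero, zero_smul, zero_add, add_zero]
    refine ext_coeff fun k => ?_
    rw [coeff_heatPlus, coeff_smul, coeff_phi]
    by_cases hk : k = 1
    · simp [hk, heatWeight, lam, max_eq_left ht]
    · simp [hk]
  have h2 := (cascadeOp M R t).le_opNorm x
  rw [hx, mul_one] at h2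
  refine le_trans ?_ h2
  refine le_trans ?_ (WithLp.norm_fst_le _ _)
  rw [h1, norm_smul, hphi, mul_one, Complex.norm_real]
  exact le_abs_self _

end State

end HeatODE

/-! ### Uniqueness of semigroups with a given generator -/

namespace C0Semigroup

variable {X : Type*} [NormedAddCommGroup X] [NormedSpace ℂ X]

lemma mem_graph_op {T : C0Semigroup X} {A : X →ₗ.[ℂ] X} (hT : T.IsGeneratedBy A) {x y : X}
    (h : (x, y) ∈ A.graph) (t : ℝ≥0) : (T.op t x, T.op t y) ∈ A.graph := by
  rw [hT] at h ⊢
  refine (((T.op t).continuous.tendsto y).comp h).congr fun s => ?_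
  simp only [Function.comp]
  rw [map_smul, map_sub, ← ContinuousLinearMap.comp_apply, ← T.op_add, add_comm t s, T.op_add,
    ContinuousLinearMap.comp_apply]

lemma hasDerivWithinAt_op {T : C0Semigroup X} {A : X →ₗ.[ℂ] X} (hT : T.IsGeneratedBy A) {x y : X}
    (h : (x, y) ∈ A.graph) {t : ℝ} (ht : 0 ≤ t) :
    HasDerivWithinAt (fun t : ℝ => T.op t.toNNReal x) (T.op t.toNNReal y) (Set.Ici t) t := by
  have h1 := (hT _ _).1 (mem_graph_op hT h t.toNNReal)
  have h2 := (tendsto_nhdsGT_coe_iff (F := fun h : ℝ => (h : ℂ)⁻¹ •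
    (T.op h.toNNReal (T.op t.toNNReal x) - T.op t.toNNReal x))).1 (by simpa using h1)
  rw [hasDerivWithinAt_iff_tendsto_slope, Set.Ici_sdiff_left]
  have h3 : Tendsto (fun s : ℝ => s - t) (𝓝[>] t) (𝓝[>] 0) := by
    refine tendsto_nhdsWithin_iff.2 ⟨?_, ?_⟩
    · have : Continuous fun s : ℝ => s - t := by fun_prop
      have := this.tendsto t
      rw [sub_self] at this
      exact this.mono_left nhdsWithin_le_nhds
    · filter_upwards [self_mem_nhdsWithin] with s hs using sub_pos.2 (Set.mem_Ioi.1 hs)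
  refine (h2.comp h3).congr' ?_
  filter_upwards [self_mem_nhdsWithin] with s (hs : t < s)
  simp only [Function.comp]
  rw [slope_def_module, ← ContinuousLinearMap.comp_apply, ← T.op_add,
    ← Real.toNNReal_add (sub_nonneg.2 hs.le) ht, sub_add_cancel, ← Complex.ofReal_inv,
    Complex.coe_smul]

variable [CompleteSpace X]

/-- Otherwise there are times t_k → 0 with ‖T(t_k)‖ > k, while every orbit is bounded along t_k;
this contradicts the uniform boundedness principle. -/
lemma exists_norm_le_near_zero (T : C0Semigroup X) :
    ∃ δ : ℝ≥0, 0 < δ ∧ ∃ C : ℝ, ∀ t ≤ δ, ‖T.op t‖ ≤ C := by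
  by_contra! hcon
  choose t ht hn using fun k : ℕ => hcon (1 / ((k : ℝ≥0) + 1)) (by positivity) k
  have ht0 : Tendsto t atTop (𝓝 0) :=
    tendsto_of_tendsto_of_tendsto_of_le_of_le tendsto_const_nhds
      (tendsto_one_div_add_atTop_nhds_zero_nat (𝕜 := ℝ≥0)) (fun _ => zero_le) ht
  obtain ⟨C, hC⟩ := banach_steinhaus (g := fun k => T.op (t k)) fun x => by
    obtain ⟨C, hC⟩ := ((T.tendsto_zero x).comp ht0).norm.bddAbove_range
    exact ⟨C, fun k => hC ⟨k, rfl⟩⟩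
  obtain ⟨k, hk⟩ := exists_nat_gt C
  exact absurd (hC k) (not_le.2 (hk.trans (hn k)))

lemma exists_norm_le (T : C0Semigroup X) (b : ℝ≥0) : ∃ C : ℝ, ∀ t ≤ b, ‖T.op t‖ ≤ C := by
  obtain ⟨δ, hδ, C, hC⟩ := T.exists_norm_le_near_zero
  have hC0 : 0 ≤ C := (norm_nonneg _).trans (hC 0 zero_le)
  have h : ∀ k : ℕ, ∃ C' : ℝ, ∀ t ≤ k * δ, ‖T.op t‖ ≤ C' := by
    intro k
    induction k with
    | zero => exact ⟨C, fun t ht => hC t (ht.trans (by simp))⟩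
    | succ k ih =>
      obtain ⟨C', hC'⟩ := ih
      refine ⟨max C (C * C'), fun t ht => ?_⟩
      rcases le_total t δ with h1 | h1
      · exact (hC t h1).trans (le_max_left _ _)
      · obtain ⟨s, rfl⟩ := exists_add_of_le h1
        have hs : s ≤ k * δ := by
          rw [Nat.cast_succ, add_mul, one_mul, add_comm] at ht
          exact le_of_add_le_add_right ht
        rw [T.op_add]
        exact ((ContinuousLinearMap.opNorm_comp_le _ _).trans
          (mul_le_mul (hC δ le_rfl) (hC' s hs) (norm_nonneg _) hC0)).trans (le_max_right _ _)
  obtain ⟨k, hk⟩ := exists_nat_ge (b / δ)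
  obtain ⟨C', hC'⟩ := h k
  exact ⟨C', fun t ht => hC' t (ht.trans ((div_le_iff₀ hδ).1 hk))⟩

lemma continuous_op_apply (T : C0Semigroup X) (x : X) : Continuous fun t => T.op t x := by
  rw [continuous_iff_continuousAt]
  intro t₀
  obtain ⟨C, hC⟩ := T.exists_norm_le (t₀ + 1)
  rw [ContinuousAt, tendsto_iff_norm_sub_tendsto_zero]
  have hd : Tendsto (fun t : ℝ≥0 => nndist t t₀) (𝓝 t₀) (𝓝 0) := by
    have : Continuous fun t : ℝ≥0 => nndist t t₀ := by fun_prop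
    simpa using this.tendsto t₀
  have h1 : Tendsto (fun t : ℝ≥0 => C * ‖T.op (nndist t t₀) x - x‖) (𝓝 t₀) (𝓝 0) := by
    have := (tendsto_iff_norm_sub_tendsto_zero.1 ((T.tendsto_zero x).comp hd)).const_mul C
    simpa using this
  refine squeeze_zero' (Eventually.of_forall fun _ => norm_nonneg _) ?_ h1
  filter_upwards [Iic_mem_nhds (lt_add_of_pos_right t₀ one_pos)] with t ht
  have key : ∀ s r : ℝ≥0, s ≤ t₀ + 1 → ‖T.op (s + r) x - T.op s x‖ ≤ C * ‖T.op r x - x‖ := by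
    intro s r hs
    rw [T.op_add, ContinuousLinearMap.comp_apply, ← map_sub]
    exact ((T.op s).le_opNorm _).trans (mul_le_mul_of_nonneg_right (hC s hs) (norm_nonneg _))
  rcases le_total t₀ t with h | h
  · obtain ⟨r, rfl⟩ := exists_add_of_le h
    have e : nndist (t₀ + r) t₀ = r := by
      ext; simp [NNReal.dist_eq]
    rw [e]
    exact key t₀ r le_self_add
  · obtain ⟨r, hr⟩ := exists_add_of_le h
    have e : nndist t t₀ = r := by
      ext; rw [coe_nndist, NNReal.dist_eq, hr]; simp
    rw [e, norm_sub_rev]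
    nth_rewrite 1 [hr]
    exact key t r ht

/-- If a bounded operator `Q` intertwines the common generator of two semigroups with a bounded
operator, then the semigroups agree after composition with `Q`, on the domain of the generator. -/
lemma intertwined_op_eq {W : Type*} [NormedAddCommGroup W] [NormedSpace ℂ W]
    {T T' : C0Semigroup X} {A : X →ₗ.[ℂ] X} (hT : T.IsGeneratedBy A) (hT' : T'.IsGeneratedBy A)
    (Q : X →L[ℂ] W) (M : W →L[ℂ] W) (hQ : ∀ x y, (x, y) ∈ A.graph → Q y = M (Q x))
    {x y : X} (h : (x, y) ∈ A.graph) (t : ℝ≥0) : Q (T.op t x) = Q (T'.op t x) := by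
  have hcont : ∀ S : C0Semigroup X, Continuous fun t : ℝ => Q (S.op t.toNNReal x) := fun S =>
    Q.continuous.comp ((S.continuous_op_apply x).comp continuous_real_toNNReal)
  have hder : ∀ {S : C0Semigroup X}, S.IsGeneratedBy A → ∀ s : ℝ, 0 ≤ s →
      HasDerivWithinAt (fun t : ℝ => Q (S.op t.toNNReal x)) (M (Q (S.op s.toNNReal x)))
        (Set.Ici s) s := by
    intro S hS s hs
    rw [← hQ _ _ (mem_graph_op hS h s.toNNReal)]
    exact (Q.restrictScalars ℝ).hasFDerivAt.comp_hasDerivWithinAt s (hasDerivWithinAt_op hS h hs)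
  -- Both curves solve w' = Mw with a Lipschitz right-hand side and the same initial value; right
  -- derivatives suffice for uniqueness.
  have := ODE_solution_unique (v := fun _ w => M w) (K := ‖M‖₊) (a := 0) (b := t)
    (fun _ => M.lipschitz) (hcont T).continuousOn (fun s hs => hder hT s hs.1)
    (hcont T').continuousOn (fun s hs => hder hT' s hs.1)
    (by simp [T.op_zero, T'.op_zero]) (Set.right_mem_Icc.2 t.2)
  simpa using this

end C0Semigroup

namespace HeatODE

/-! ### The closed-loop system -/

section ClosedLoop

variable {n m : ℕ} (b : Fin n → Lp ℝ 2 unitMeasure) (G : Matrix (Fin n) (Fin n) ℝ)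
  (H : Matrix (Fin n) (Fin m) ℝ) (F1 : L2 →L[ℂ] EuclideanSpace ℂ (Fin m))
  (F2 : Matrix (Fin m) (Fin n) ℂ) (f : EuclideanSpace ℂ (Fin m))

/-- The closed-loop dynamics of the mean temperature and the state of the ordinary differential
equation. -/
def slowOp : SlowState n →L[ℂ] SlowState n :=
  (coeffL 0 ∘L B1 b ∘L ContinuousLinearMap.snd ℂ ℂ (EuclideanSpace ℂ (Fin n))).prod
    ((ContinuousLinearMap.fst ℂ ℂ (EuclideanSpace ℂ (Fin n))).smulRight (matOp (toC H) f)
      + (matOp (toC G) + matOp (toC H) ∘L matOp F2) ∘L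
        ContinuousLinearMap.snd ℂ ℂ (EuclideanSpace ℂ (Fin n)))

lemma slowOp_apply (w : SlowState n) : slowOp b G H F2 f w = (coeff 0 (B1 b w.2),
    w.1 • matOp (toC H) f + (matOp (toC G) w.2 + matOp (toC H) (matOp F2 w.2))) := rfl

/-- The action of the finite-dimensional part on the heat equation. -/
def slowInput : SlowState n →L[ℂ] L2 :=
  B1 b ∘L ContinuousLinearMap.snd ℂ ℂ (EuclideanSpace ℂ (Fin n))

lemma mem_graph_closedLoopOp_iff (x y : State n) :
    (x, y) ∈ (closedLoopOp b G H F1 F2).graph ↔ ∃ hx : x.fst ∈ heatOp.domain,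
      y.fst = heatOp ⟨x.fst, hx⟩ + B1 b x.snd ∧
      y.snd = matOp (toC H) (F1 x.fst + matOp F2 x.snd) + matOp (toC G) x.snd := by
  have happ : ∀ x : (closedLoopOp b G H F1 F2).domain, closedLoopOp b G H F1 F2 x
      = ctrlOp H (feedbackOp F1 F2 (x : State n)) + sysOp b G ⟨x, x.2⟩ := fun _ => rfl
  rw [LinearPMap.mem_graph_iff]
  constructor
  · rintro ⟨⟨x, hx⟩, rfl, rfl⟩
    refine ⟨hx, ?_, ?_⟩
    · rw [happ, WithLp.add_fst]
      exact zero_add _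
    · rw [happ, WithLp.add_snd]
      rfl
  · rintro ⟨hx, h1, h2⟩
    refine ⟨⟨x, hx⟩, rfl, state_ext ?_ ?_⟩
    · rw [happ, WithLp.add_fst, h1]
      exact zero_add _
    · rw [happ, WithLp.add_snd, h2]
      rfl

variable {F1 f}

/-- The forcing B₁z₂ enters in two pieces, its mean through the slow system and the rest through the
heat flow; in the limit they add up to B₁z₂. -/
lemma isGeneratedBy_closedLoopOp (hF1 : ∀ x₁ : L2, F1 x₁ = coeff 0 x₁ • f) :
    (cascadeSemigroup (slowOp b G H F2 f) (slowInput b)).IsGeneratedBy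
      (closedLoopOp b G H F1 F2) := by
  intro x y
  rw [mem_graph_closedLoopOp_iff]
  refine Iff.trans ?_ ((tendsto_cascade_quotient_iff (slowOp b G H F2 f) (slowInput b) x
    y).symm.trans tendsto_nhdsGT_coe_iff.symm)
  refine exists_congr fun hx => and_congr ?_ ?_
  · have h : slowInput b (slowPart n x) = B1 b x.snd := rfl
    rw [slowOp_apply, h, heatPlus_zero, slowPart_apply, add_sub_cancel, add_comm]
  · rw [slowOp_apply, hF1, slowPart_apply, map_add, map_smul]
    dsimp only
    rw [add_assoc, add_comm (matOp (toC H) (matOp F2 x.snd))]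

lemma dense_closedLoopOp_domain : Dense ((closedLoopOp b G H F1 F2).domain : Set (State n)) := by
  have h : ((closedLoopOp b G H F1 F2).domain : Set (State n))
      = (fun x : State n => x.fst) ⁻¹' (heatDomain : Set L2) := rfl
  rw [h]
  refine dense_heatDomain.preimage ?_
  exact isOpenMap_fst.comp (WithLp.prodContinuousLinearEquiv 2 ℂ L2
    (EuclideanSpace ℂ (Fin n))).toHomeomorph.isOpenMap

/-- A semigroup is determined by the closed-loop operator. -/
lemma op_eq_of_isGeneratedBy (hF1 : ∀ x₁ : L2, F1 x₁ = coeff 0 x₁ • f)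
    {T T' : C0Semigroup (State n)} (hT : T.IsGeneratedBy (closedLoopOp b G H F1 F2))
    (hT' : T'.IsGeneratedBy (closedLoopOp b G H F1 F2)) (t : ℝ≥0) : T.op t = T'.op t := by
  refine ContinuousLinearMap.coeFn_injective (Continuous.ext_on
    (dense_closedLoopOp_domain (F1 := F1) b G H F2) (T.op t).continuous (T'.op t).continuous
    fun x hx => ?_)
  have hgraph := LinearPMap.mem_graph (closedLoopOp b G H F1 F2) ⟨x, hx⟩
  -- A single cosine coefficient together with the slow state satisfies a closed finite-dimensional
  -- linear equation with matrix `N k`.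
  let P (k : ℕ) : State n →L[ℂ] ℂ × SlowState n :=
    (coeffL k ∘L WithLp.fstL 2 ℂ L2 (EuclideanSpace ℂ (Fin n))).prod (slowPart n)
  let N (k : ℕ) : ℂ × SlowState n →L[ℂ] ℂ × SlowState n :=
    ((-lam k : ℂ) • ContinuousLinearMap.fst ℂ ℂ (SlowState n)
      + coeffL k ∘L slowInput b ∘L ContinuousLinearMap.snd ℂ ℂ (SlowState n)).prod
      (slowOp b G H F2 f ∘L ContinuousLinearMap.snd ℂ ℂ (SlowState n))
  have hPN : ∀ k (x y : State n), (x, y) ∈ (closedLoopOp b G H F1 F2).graph →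
      P k y = N k (P k x) := by
    intro k x y hxy
    obtain ⟨hx, h1, h2⟩ := (mem_graph_closedLoopOp_iff b G H F1 F2 x y).1 hxy
    change (coeff k y.fst, (coeff 0 y.fst, y.snd))
      = ((-lam k : ℂ) • coeff k x.fst + coeff k (B1 b x.snd), slowOp b G H F2 f (slowPart n x))
    rw [slowOp_apply, slowPart_apply, h1, h2, coeff_add, coeff_add, coeff_heatOp, coeff_heatOp,
      lam_zero, hF1, map_add, map_smul]
    simp only [smul_eq_mul, Complex.ofReal_zero, neg_zero, zero_mul, zero_add, Prod.mk.injEq,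
      true_and]
    abel
  have key : ∀ k, P k (T.op t x) = P k (T'.op t x) := fun k =>
    C0Semigroup.intertwined_op_eq hT hT' (P k) (N k) (hPN k) hgraph t
  exact state_ext (ext_coeff fun k => congrArg Prod.fst (key k))
    (congrArg (fun w => w.2.2) (key 0))

end ClosedLoop

end HeatODE

/-! ### Values of rational functions -/

namespace RatFunc

/-- The rational function `r` is regular at `z`, with value `c`. -/
def HasValueAt (r : RatFunc ℂ) (z c : ℂ) : Prop :=
  ∃ p q : Polynomial ℂ, q.eval z ≠ 0 ∧
    r * algebraMap (Polynomial ℂ) (RatFunc ℂ) q = algebraMap (Polynomial ℂ) (RatFunc ℂ) p ∧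
    p.eval z = c * q.eval z

variable {r s : RatFunc ℂ} {z c d : ℂ}

/-- By cross-multiplication; the representing fractions need not be in lowest terms, which makes
values easy to add and multiply. -/
lemma HasValueAt.unique (hc : r.HasValueAt z c) (hd : r.HasValueAt z d) : c = d := by
  obtain ⟨p, q, hq, h, he⟩ := hc
  obtain ⟨p', q', hq', h', he'⟩ := hd
  have h1 : p * q' = p' * q := by
    apply RatFunc.algebraMap_injective ℂ
    rw [map_mul, map_mul, ← h, ← h']
    ring
  have h2 := congrArg (Polynomial.eval z) h1
  rw [Polynomial.eval_mul, Polynomial.eval_mul, he, he'] at h2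
  exact mul_right_cancel₀ (mul_ne_zero hq hq') (by linear_combination h2)

lemma hasValueAt_algebraMap (p : Polynomial ℂ) (z : ℂ) :
    HasValueAt (algebraMap (Polynomial ℂ) (RatFunc ℂ) p) z (p.eval z) :=
  ⟨p, 1, by simp, by simp, by simp⟩

lemma hasValueAt_C (a z : ℂ) : HasValueAt (RatFunc.C a) z a := by
  simpa using hasValueAt_algebraMap (Polynomial.C a) z

lemma hasValueAt_X (z : ℂ) : HasValueAt RatFunc.X z z := by
  simpa using hasValueAt_algebraMap Polynomial.X z

lemma hasValueAt_zero (z : ℂ) : HasValueAt 0 z 0 := by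
  simpa using hasValueAt_algebraMap 0 z

lemma hasValueAt_one (z : ℂ) : HasValueAt 1 z 1 := by
  simpa using hasValueAt_algebraMap 1 z

lemma HasValueAt.add (hc : r.HasValueAt z c) (hd : s.HasValueAt z d) :
    (r + s).HasValueAt z (c + d) := by
  obtain ⟨p, q, hq, h, he⟩ := hc
  obtain ⟨p', q', hq', h', he'⟩ := hd
  refine ⟨p * q' + p' * q, q * q', by simp [hq, hq'], ?_, ?_⟩
  · simp only [map_add, map_mul, ← h, ← h']
    ring
  · simp only [Polynomial.eval_add, Polynomial.eval_mul, he, he']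
    ring

lemma HasValueAt.mul (hc : r.HasValueAt z c) (hd : s.HasValueAt z d) :
    (r * s).HasValueAt z (c * d) := by
  obtain ⟨p, q, hq, h, he⟩ := hc
  obtain ⟨p', q', hq', h', he'⟩ := hd
  refine ⟨p * p', q * q', by simp [hq, hq'], ?_, ?_⟩
  · simp only [map_mul, ← h, ← h']
    ring
  · simp only [Polynomial.eval_mul, he, he']
    ring

lemma HasValueAt.sub (hc : r.HasValueAt z c) (hd : s.HasValueAt z d) :
    (r - s).HasValueAt z (c - d) := by
  have h := hc.add ((hasValueAt_C (-1) z).mul hd)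
  have e1 : r + RatFunc.C (-1) * s = r - s := by rw [map_neg, map_one]; ring
  have e2 : c + -1 * d = c - d := by ring
  rwa [e1, e2] at h

lemma HasValueAt.sum {ι : Type*} (t : Finset ι) {r : ι → RatFunc ℂ} {c : ι → ℂ}
    (h : ∀ i, (r i).HasValueAt z (c i)) : (∑ i ∈ t, r i).HasValueAt z (∑ i ∈ t, c i) := by
  classical
  induction t using Finset.induction_on with
  | empty => simpa using hasValueAt_zero z
  | insert i t hi ih =>
    rw [Finset.sum_insert hi, Finset.sum_insert hi]
    exact (h i).add ih

lemma exists_hasValueAt (h : ¬ r.IsPole z) : ∃ c, r.HasValueAt z c := by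
  have hq : r.denom.eval z ≠ 0 := h
  refine ⟨r.num.eval z / r.denom.eval z, r.num, r.denom, hq, ?_, (div_mul_cancel₀ _ hq).symm⟩
  have h1 : algebraMap (Polynomial ℂ) (RatFunc ℂ) r.denom ≠ 0 :=
    RatFunc.algebraMap_ne_zero r.denom_ne_zero
  rw [← eq_div_iff h1, RatFunc.num_div_denom]

end RatFunc

namespace HeatODE

/-! ### Eigenvalues of the closed loop and poles of the transfer functions -/

section Transfer

variable {n m : ℕ} (b : Fin n → Lp ℝ 2 unitMeasure) (G : Matrix (Fin n) (Fin n) ℝ)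
  (H : Matrix (Fin n) (Fin m) ℝ) (F2 : Matrix (Fin m) (Fin n) ℂ) (f : EuclideanSpace ℂ (Fin m))

lemma matOp_apply {k l : ℕ} (M : Matrix (Fin l) (Fin k) ℂ) (v : EuclideanSpace ℂ (Fin k))
    (i : Fin l) : matOp M v i = M.mulVec (fun j => v j) i := rfl

lemma coeff_zero_B1 (v : EuclideanSpace ℂ (Fin n)) :
    coeff 0 (B1 b v) = BPlus b ⬝ᵥ (fun i => v i) := by
  rw [← coeffL_apply, B1]
  simp [dotProduct, BPlus, mul_comm]

/-- `λ I - G - H F₂` as a matrix of rational functions. -/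
def pencil : Matrix (Fin n) (Fin n) (RatFunc ℂ) :=
  Matrix.scalar (Fin n) RatFunc.X - (toC G).map RatFunc.C - (toC H * F2).map RatFunc.C

/-- The determinant is the characteristic polynomial of G + HF₂, which is monic, so the matrix
inverse in `transfer2` is a genuine one. -/
lemma pencil_mul_transfer2 : pencil G H F2 * transfer2 G H F2 = 1 := by
  refine Matrix.mul_nonsing_inv _ (isUnit_iff_ne_zero.2 ?_)
  have h : pencil G H F2 = (algebraMap (Polynomial ℂ) (RatFunc ℂ)).mapMatrix
      (Matrix.charmatrix (toC G + toC H * F2)) := by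
    ext i j
    simp only [pencil, Matrix.sub_apply, Matrix.map_apply, RingHom.mapMatrix_apply,
      Matrix.charmatrix_apply, Matrix.scalar_apply, Matrix.diagonal_apply, Matrix.add_apply]
    split_ifs <;> simp <;> ring
  rw [h, ← RingHom.map_det]
  exact RatFunc.algebraMap_ne_zero (Matrix.charpoly_monic _).ne_zero

lemma hasValueAt_pencil (z : ℂ) (i j : Fin n) :
    (pencil G H F2 i j).HasValueAt z
      ((Matrix.scalar (Fin n) z - (toC G + toC H * F2)) i j) := by
  have h1 : (Matrix.scalar (Fin n) (RatFunc.X : RatFunc ℂ) i j).HasValueAt z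
      (Matrix.scalar (Fin n) z i j) := by
    rw [Matrix.scalar_apply, Matrix.scalar_apply, Matrix.diagonal_apply, Matrix.diagonal_apply]
    split_ifs
    · exact RatFunc.hasValueAt_X z
    · exact RatFunc.hasValueAt_zero z
  have h := (h1.sub (RatFunc.hasValueAt_C (toC G i j) z)).sub
    (RatFunc.hasValueAt_C ((toC H * F2) i j) z)
  rw [sub_sub (Matrix.scalar (Fin n) z i j)] at h
  exact h

/-- Where the entries of `G₂` are regular, their values form the resolvent of `G + H F₂`. -/
lemma exists_resolvent {z : ℂ} (h2 : ∀ i j, ¬ (transfer2 G H F2 i j).IsPole z) :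
    ∃ ρ : Matrix (Fin n) (Fin n) ℂ, (∀ i j, (transfer2 G H F2 i j).HasValueAt z (ρ i j)) ∧
      (Matrix.scalar (Fin n) z - (toC G + toC H * F2)) * ρ = 1 := by
  choose ρ hρ using fun i j => RatFunc.exists_hasValueAt (h2 i j)
  refine ⟨Matrix.of ρ, hρ, ?_⟩
  ext i k
  have h3 : ((pencil G H F2 * transfer2 G H F2) i k).HasValueAt z
      (((Matrix.scalar (Fin n) z - (toC G + toC H * F2)) * Matrix.of ρ) i k) := by
    rw [Matrix.mul_apply, Matrix.mul_apply]
    exact RatFunc.HasValueAt.sum _ fun j => (hasValueAt_pencil G H F2 z i j).mul (hρ j k)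
  rw [pencil_mul_transfer2] at h3
  refine h3.unique ?_
  rw [Matrix.one_apply, Matrix.one_apply]
  split_ifs
  · exact RatFunc.hasValueAt_one z
  · exact RatFunc.hasValueAt_zero z

/-- The reciprocal of `G₁`. -/
def transferDen : RatFunc ℂ :=
  RatFunc.X - (fun i => RatFunc.C (BPlus b i)) ⬝ᵥ
    (transfer2 G H F2).mulVec (fun i => RatFunc.C ((toC H).mulVec f i))

lemma hasValueAt_transferDen {z : ℂ} {ρ : Matrix (Fin n) (Fin n) ℂ}
    (hρ : ∀ i j, (transfer2 G H F2 i j).HasValueAt z (ρ i j)) :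
    (transferDen b G H F2 f).HasValueAt z
      (z - BPlus b ⬝ᵥ ρ.mulVec ((toC H).mulVec f)) := by
  refine (RatFunc.hasValueAt_X z).sub (RatFunc.HasValueAt.sum _ fun i => ?_)
  refine (RatFunc.hasValueAt_C _ z).mul ?_
  simp only [Matrix.mulVec, dotProduct]
  exact RatFunc.HasValueAt.sum _ fun j => (hρ i j).mul (RatFunc.hasValueAt_C _ z)

/-- `B⁺ (λ I - G - H F₂)⁻¹ H f` is bounded at infinity, so it differs from `λ`. -/
lemma transferDen_ne_zero
    (h2 : ∀ (i j : Fin n) (z : ℂ), (transfer2 G H F2 i j).IsPole z → z.re < 0) :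
    transferDen b G H F2 f ≠ 0 := by
  intro h0
  set K := matOp (toC G + toC H * F2) with hK
  set β := coeffL 0 ∘L B1 b with hβ
  set h : EuclideanSpace ℂ (Fin n) := matOp (toC H) f with hh
  -- With w = (t - K)⁻¹h, the excess of t over ‖K‖ + 1 is nonnegative, so ‖w‖ ≤ ‖h‖; then t = βw
  -- gives t ≤ ‖β‖‖h‖, which this t exceeds.
  set t : ℝ := ‖K‖ + 1 + ‖β‖ * ‖h‖ with ht
  have ht0 : 0 ≤ t := by positivity
  obtain ⟨ρ, hρ, hinv⟩ := exists_resolvent G H F2 (z := (t : ℂ)) fun i j hp => by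
    have := h2 i j _ hp
    rw [Complex.ofReal_re] at this
    linarith
  have hv := hasValueAt_transferDen b G H F2 f hρ
  rw [h0] at hv
  have hv0 := hv.unique (RatFunc.hasValueAt_zero _)
  let w : EuclideanSpace ℂ (Fin n) := WithLp.toLp 2 (ρ.mulVec ((toC H).mulVec f))
  have hβw : (t : ℂ) = β w := by
    rw [hβ, ContinuousLinearMap.comp_apply, coeffL_apply, coeff_zero_B1]
    exact sub_eq_zero.1 hv0
  have hw : (t : ℂ) • w - K w = h := by
    have h3 : (Matrix.scalar (Fin n) (t : ℂ) - (toC G + toC H * F2)).mulVec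
        (ρ.mulVec ((toC H).mulVec f)) = (toC H).mulVec f := by
      rw [Matrix.mulVec_mulVec, hinv, Matrix.one_mulVec]
    ext i
    have h4 := congrFun h3 i
    rw [Matrix.sub_mulVec, Matrix.scalar_apply, Pi.sub_apply, Matrix.mulVec_diagonal] at h4
    exact h4
  have h5 : t * ‖w‖ ≤ ‖h‖ + ‖K‖ * ‖w‖ := by
    have h6 : (t : ℂ) • w = h + K w := by rw [← hw]; abel
    have h7 := norm_add_le h (K w)
    rw [← h6, norm_smul, Complex.norm_real, Real.norm_of_nonneg ht0] at h7
    linarith [K.le_opNorm w]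
  have h8 : t ≤ ‖β‖ * ‖w‖ := by
    have h9 := β.le_opNorm w
    rwa [← hβw, Complex.norm_real, Real.norm_of_nonneg ht0] at h9
  have h10 : ‖w‖ ≤ ‖h‖ := by
    nlinarith [norm_nonneg w, mul_nonneg (mul_nonneg (norm_nonneg β) (norm_nonneg h))
      (norm_nonneg w)]
  nlinarith [norm_nonneg K, norm_nonneg β, mul_le_mul_of_nonneg_left h10 (norm_nonneg β)]

/-- If the poles of both transfer functions lie in the open left half plane, then so do the
eigenvalues of the finite-dimensional part of the closed loop. -/
lemma slowOp_eigenvalue_re_neg (h1 : ∀ z : ℂ, (transfer1 b G H f F2).IsPole z → z.re < 0)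
    (h2 : ∀ (i j : Fin n) (z : ℂ), (transfer2 G H F2 i j).IsPole z → z.re < 0)
    (z : ℂ) (w : SlowState n) (hw : w ≠ 0) (hz : slowOp b G H F2 f w = z • w) : z.re < 0 := by
  by_contra hre
  apply hw
  obtain ⟨ρ, hρ, hinv⟩ := exists_resolvent G H F2 (z := z) fun i j hp => hre (h2 i j z hp)
  have hinv' := mul_eq_one_comm.1 hinv
  obtain ⟨g, hg⟩ := RatFunc.exists_hasValueAt (fun hp => hre (h1 z hp))
  have hd := hasValueAt_transferDen b G H F2 f hρ
  -- As 0⁻¹ = 0 in `RatFunc`, the hypothesis on G₁ carries information only because its denominator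
  -- is not identically zero.
  have hmul : transfer1 b G H f F2 * transferDen b G H F2 f = 1 :=
    inv_mul_cancel₀ (transferDen_ne_zero b G H F2 f h2)
  have hgd := hg.mul hd
  rw [hmul] at hgd
  have hgd1 := hgd.unique (RatFunc.hasValueAt_one z)
  have hd0 : z - BPlus b ⬝ᵥ ρ.mulVec ((toC H).mulVec f) ≠ 0 := by
    intro h0
    rw [h0, mul_zero] at hgd1
    exact zero_ne_one hgd1
  obtain ⟨a, v⟩ := w
  rw [slowOp_apply] at hz
  have hz1 : coeff 0 (B1 b v) = z * a := congrArg Prod.fst hz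
  have hz2 : a • matOp (toC H) f + (matOp (toC G) v + matOp (toC H) (matOp F2 v)) = z • v :=
    congrArg Prod.snd hz
  -- The second row of the eigenvalue equation determines v as a times the resolvent applied to Hf;
  -- inserted into the first row it leaves a times the denominator of G₁ at z.
  have hz3 : (Matrix.scalar (Fin n) z - (toC G + toC H * F2)).mulVec (fun i => v i)
      = a • (toC H).mulVec f := by
    funext i
    have h4 := congrArg (fun u : EuclideanSpace ℂ (Fin n) => u i) hz2
    have h5 : matOp (toC H) (matOp F2 v) i = ((toC H * F2).mulVec (fun i => v i)) i := by
      rw [← Matrix.mulVec_mulVec]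
      rfl
    simp only [PiLp.add_apply, PiLp.smul_apply, h5] at h4
    rw [Matrix.sub_mulVec, Matrix.scalar_apply, Pi.sub_apply, Matrix.mulVec_diagonal,
      Matrix.add_mulVec, Pi.add_apply, Pi.smul_apply]
    rw [matOp_apply, matOp_apply, smul_eq_mul, smul_eq_mul] at h4
    rw [smul_eq_mul]
    linear_combination -h4
  have hv : (fun i => v i) = a • ρ.mulVec ((toC H).mulVec f) := by
    have h6 := congrArg ρ.mulVec hz3
    rwa [Matrix.mulVec_mulVec, hinv', Matrix.one_mulVec, Matrix.mulVec_smul] at h6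
  have ha : a = 0 := by
    rw [coeff_zero_B1, hv, dotProduct_smul, smul_eq_mul] at hz1
    have h7 : a * (z - BPlus b ⬝ᵥ ρ.mulVec ((toC H).mulVec f)) = 0 := by
      linear_combination -hz1
    exact (mul_eq_zero.1 h7).resolve_right hd0
  have hv0 : v = 0 := by
    ext i
    have h8 := congrFun hv i
    rw [ha, zero_smul] at h8
    exact h8
  rw [ha, hv0]
  rfl

end Transfer

end HeatODE

end

theorem mainTheorem9 {n m : ℕ}
    (b : Fin n → Lp ℝ 2 HeatODE.unitMeasure)
    (G : Matrix (Fin n) (Fin n) ℝ) (H : Matrix (Fin n) (Fin m) ℝ)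
    (F1 : HeatODE.L2 →L[ℂ] EuclideanSpace ℂ (Fin m)) (F2 : Matrix (Fin m) (Fin n) ℂ)
    (f : EuclideanSpace ℂ (Fin m))
    (hF1 : ∀ x₁ : HeatODE.L2, F1 x₁ = HeatODE.coeff 0 x₁ • f) :
    (∃ T : C0Semigroup (HeatODE.State n),
      T.IsGeneratedBy (HeatODE.closedLoopOp b G H F1 F2)) ∧
    ((∀ z : ℂ, (HeatODE.transfer1 b G H f F2).IsPole z → z.re < 0) →
      (∀ (i j : Fin n) (z : ℂ), (HeatODE.transfer2 G H F2 i j).IsPole z → z.re < 0) →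
      ∀ T : C0Semigroup (HeatODE.State n),
        T.IsGeneratedBy (HeatODE.closedLoopOp b G H F1 F2) → T.IsExponentiallyStable) := by
  have hgen := HeatODE.isGeneratedBy_closedLoopOp b G H F2 hF1
  refine ⟨⟨_, hgen⟩, fun h1 h2 T hT => ?_⟩
  obtain ⟨C, ε, hC, hε, hexp⟩ := exists_norm_expOp_le (HeatODE.slowOp b G H F2 f)
    (HeatODE.slowOp_eigenvalue_re_neg b G H F2 f h1 h2)
  obtain ⟨C', δ, hδ, hle⟩ := HeatODE.exists_norm_cascadeOp_le (HeatODE.slowOp b G H F2 f)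
    (HeatODE.slowInput b) hC hε hexp
  -- By uniqueness, an arbitrary semigroup with this generator inherits the bounds of the explicit
  -- one.
  have hop : ∀ t : ℝ≥0, T.op t
      = HeatODE.cascadeOp (HeatODE.slowOp b G H F2 f) (HeatODE.slowInput b) t := fun t =>
    HeatODE.op_eq_of_isGeneratedBy b G H F2 hF1 hT hgen t
  refine T.isExponentiallyStable_of_norm_le (C := C') (ε := δ) (c := Real.pi ^ 2) hδ
    (fun t => ?_) (fun t => ?_)
  · rw [hop]
    exact hle t t.2
  · rw [hop]
    exact HeatODE.exp_le_norm_cascadeOp _ _ t.2
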